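/- Let $(\Omega,\mathcal F,\mathbb Q)$ be a probability space with a filtration $\{\mathcal F_t\}_{t\ge 0}$, and let $\mathbf L=\{\mathbf L(s)\}_{s\in\mathbb R}$ be a two-sided square integrable $k$-dimensional Lévy process under $\mathbb Q$ with zero mean. Assume that $\mathbf L$ is a Lévy process with respect to the filtration: for every $t\ge 0$, $\mathbf L(s)$ is $\mathcal F_t$-measurable for all $s\in(-\infty,t]$, and $\mathbf L(u)-\mathbf L(t)$ is independent of $\mathcal F_t$ for all $u\ge t$. Let $G$ be a measurable map from $\mathbb R_+$ into the real $m\times k$ matrices whose entries belong to $L^2(\mathbb R_+)$, and let $$\mathbf X^m(t)=\int_{-\infty}^t G(t-s)\,d\mathbf L(s),\qquad t\ge 0,$$ be the associated Lévy stationary (LS) process; here and below, stochastic integrals of deterministic square integrable integrands are $L^2(\mathbb Q)$-limits of the elementary integrals of step functions. Let $0\le t\le T$ and $\mathbf z\in\mathbb R^m$, and suppose that $\mathbb E_{\mathbb Q}[\exp(\mathbf z^\top\mathbf X^m(t))]<\infty$. For $\mathbf y\in\mathbb R^k$ let $\psi_{\mathbb Q}(\mathbf y)=\log\mathbb E_{\mathbb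 Q}[\exp(\mathbf y^\top\mathbf L(1))]$ be the cumulant of $\mathbf L(1)$ under $\mathbb Q$. Then $\exp\big(\mathbf z^\top\int_{-\infty}^T G(T-s)\,d\mathbf L(s)\big)$ is $\mathbb Q$-integrable, $\psi_{\mathbb Q}(G(s)^\top\mathbf z)$ is finite for almost every $s\in(0,T-t]$ and is integrable in $s$ over $(0,T-t]$, and, $\mathbb Q$-almost surely, $$\mathbb E_{\mathbb Q}\left[\exp\left(\mathbf z^\top\int_{-\infty}^T G(T-s)\,d\mathbf L(s)\right)\Big|\,\mathcal F_t\right]=\exp\left(\mathbf z^\top\int_{-\infty}^t G(T-s)\,d\mathbf L(s)+\int_0^{T-t}\psi_{\mathbb Q}\big(G(s)^\top\mathbf z\big)\,ds\right).$$ -/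

import Mathlib

open MeasureTheory ProbabilityTheory Filter Topology Matrix
open scoped NNReal ENNReal

/-- A two-sided `k`-dimensional Lévy process under `Q`: it starts at zero, has independent and
stationary increments over the whole real line, is continuous in probability, and has
almost surely càdlàg paths. -/
structure IsTwoSidedLevy {Ω : Type*} [MeasurableSpace Ω] {k : ℕ}
    (Q : Measure Ω) (L : ℝ → Ω → Fin k → ℝ) : Prop where
  measurable : ∀ t, Measurable (L t)
  zero : ∀ᵐ ω ∂Q, L 0 ω = 0
  indep_increments : HasIndepIncrements L Q
  stationary_increments : ∀ s h : ℝ, 0 ≤ h →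
    IdentDistrib (fun ω => L (s + h) ω - L s ω) (L h) Q Q
  continuous_in_probability : ∀ s : ℝ, TendstoInMeasure Q L (𝓝 s) (L s)
  cadlag : ∀ᵐ ω ∂Q, ∀ s : ℝ, ContinuousWithinAt (fun r => L r ω) (Set.Ici s) s ∧
    ∃ l : Fin k → ℝ, Tendsto (fun r => L r ω) (𝓝[<] s) (𝓝 l)

/-- The process `L` is compatible with the filtration `(ℱ_t)_{t ≥ 0}` in the sense usual for Lévy
processes: it is adapted (the values at negative times being `ℱ_0`-measurable), and its
increments after time `t` are independent of `ℱ_t`. -/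
structure IsLevyFiltration {Ω : Type*} [mΩ : MeasurableSpace Ω] {k : ℕ}
    (Q : Measure Ω) (ℱ : Filtration ℝ≥0 mΩ) (L : ℝ → Ω → Fin k → ℝ) : Prop where
  adapted : ∀ (t : ℝ≥0) (s : ℝ), s ≤ t → Measurable[ℱ t] (L s)
  indep : ∀ t u : ℝ≥0, t ≤ u →
    Indep (MeasurableSpace.comap (fun ω => L u ω - L t ω) inferInstance) (ℱ t) Q

/-- A step function `∑ᵢ cᵢ 1_{(aᵢ, bᵢ]}` on the real line, with values in `ℝᵏ`. -/
structure StepFunction (k : ℕ) where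
  n : ℕ
  a : Fin n → ℝ
  b : Fin n → ℝ
  a_le_b : ∀ i, a i ≤ b i
  c : Fin n → Fin k → ℝ

/-- The function `s ↦ ∑ᵢ cᵢ 1_{(aᵢ, bᵢ]}(s)`. -/
noncomputable def StepFunction.eval {k : ℕ} (φ : StepFunction k) (s : ℝ) : Fin k → ℝ :=
  ∑ i, (Set.Ioc (φ.a i) (φ.b i)).indicator (fun _ => φ.c i) s

/-- The elementary integral `∫ φᵀ dL = ∑ᵢ cᵢᵀ (L(bᵢ) - L(aᵢ))`. -/
noncomputable def StepFunction.integral {Ω : Type*} {k : ℕ} (φ : StepFunction k)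
    (L : ℝ → Ω → Fin k → ℝ) (ω : Ω) : ℝ :=
  ∑ i, φ.c i ⬝ᵥ (L (φ.b i) ω - L (φ.a i) ω)

/-- `I` is a version of the stochastic integral `∫_ℝ f(s)ᵀ dL(s)` of the deterministic integrand
`f ∈ L²(ℝ; ℝᵏ)`: it is the `L²(Q)`-limit of the elementary integrals of step functions that
converge to `f` in `L²(ℝ; ℝᵏ)`. -/
def IsLevyIntegral {Ω : Type*} [MeasurableSpace Ω] {k : ℕ} (Q : Measure Ω)
    (L : ℝ → Ω → Fin k → ℝ) (f : ℝ → Fin k → ℝ) (I : Ω → ℝ) : Prop :=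
  MemLp f 2 volume ∧ MemLp I 2 Q ∧ ∃ φ : ℕ → StepFunction k,
    Tendsto (fun n => eLpNorm (fun s => (φ n).eval s - f s) 2 volume) atTop (𝓝 0) ∧
    Tendsto (fun n => eLpNorm (fun ω => (φ n).integral L ω - I ω) 2 Q) atTop (𝓝 0)

open Classical in
/-- The stochastic integral `∫_ℝ f(s)ᵀ dL(s)`. For a square integrable Lévy process `L` with mean
zero and `f ∈ L²(ℝ; ℝᵏ)` it exists and is unique up to `Q`-null sets, by the Itô isometry. -/
noncomputable def levyIntegral {Ω : Type*} [MeasurableSpace Ω] {k : ℕ} (Q : Measure Ω)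
    (L : ℝ → Ω → Fin k → ℝ) (f : ℝ → Fin k → ℝ) : Ω → ℝ :=
  if h : ∃ I, IsLevyIntegral Q L f I then h.choose else 0

/-- The random vector `∫_{-∞}^t G(T - s) dL(s)` in `ℝᵐ`; its `i`-th coordinate is
`∫_{-∞}^t ∑ⱼ Gᵢⱼ(T - s) dLⱼ(s)`. Only the values of `G` on `[T - t, ∞)` matter. -/
noncomputable def kernelIntegral {Ω : Type*} [MeasurableSpace Ω] {m k : ℕ} (Q : Measure Ω)
    (L : ℝ → Ω → Fin k → ℝ) (G : ℝ → Matrix (Fin m) (Fin k) ℝ) (T t : ℝ) (ω : Ω) : Fin m → ℝ :=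
  fun i => levyIntegral Q L ((Set.Iic t).indicator fun s => G (T - s) i) ω

/-- The Lévy stationary process `X(t) = ∫_{-∞}^t G(t - s) dL(s)`. -/
noncomputable def lsProcess {Ω : Type*} [MeasurableSpace Ω] {m k : ℕ} (Q : Measure Ω)
    (L : ℝ → Ω → Fin k → ℝ) (G : ℝ → Matrix (Fin m) (Fin k) ℝ) (t : ℝ) (ω : Ω) : Fin m → ℝ :=
  kernelIntegral Q L G t t ω

/-- The (real) cumulant function `y ↦ log E_Q[exp(yᵀ Y)]` of a random vector `Y`. -/
noncomputable def cumulant {Ω : Type*} [MeasurableSpace Ω] {k : ℕ} (Q : Measure Ω)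
    (Y : Ω → Fin k → ℝ) (y : Fin k → ℝ) : ℝ :=
  Real.log (∫ ω, Real.exp (y ⬝ᵥ Y ω) ∂Q)

/-! Cut the integral over (-∞, T] at t. The part over (-∞, t] is a.e. `ℱ t`-measurable, while the
part Z over (t, T] is a limit of combinations of increments after t and so is independent of `ℱ t`.
The conditional expectation is therefore exp of the first part times E[exp Z], and it remains to
compute E[exp Z].

The heart is the identity log E[exp(∫ fᵀ dL)] = ∫ ψ(f(s)) ds for every f in L²
(`levyCumulant_eq_lintegral`), proved in [0, ∞] with no assumption on exponential moments. Centred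
variables have E[exp X] ≥ 1, so all logarithms lie in [0, ∞] and nothing of the form ∞ - ∞ occurs.
Substituting s ↦ r - s, the cumulants of the full integrals at r = t and r = T are both ∫ ψ(G(s)ᵀz)
ds over [0, ∞). The single moment hypothesis at time t makes this finite, and all the integrability
claims follow.

For the identity, let fₙ be the averages of f over the cells of a finer and finer grid. It holds for
fₙ by independence and stationarity of increments. Upper bound: convexity of ψ gives ∫ ψ(fₙ) ≤ ∫
ψ(f) (`extCumulant_average_le`), and Fatou along an a.s. convergent subsequence bounds the moment of
∫ fᵀ dL. Lower bound: ψ is lower semicontinuous, so ∫ ψ(f) ≤ liminf ∫ ψ(fₙ), and it suffices that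
averaging f over a cell (a, b] does not increase the exponential moment
(`IsLevyIntegral.expMoment_average_le`). That is conditional Jensen: by exchangeability of
increments, the integral of f over (a, b] has conditional expectation cᵀ(L(b) - L(a)) given L(b) -
L(a), with c the average of f. -/

set_option linter.unusedSectionVars false

/-! ### Additive functions on an interval -/

/-- A bounded additive function on `[0, h]` is linear. -/
theorem eq_div_mul_of_additive_of_bounded {h : ℝ} (hh : 0 < h) {v : ℝ → ℝ}
    (hadd : ∀ s t, 0 ≤ s → 0 ≤ t → s + t ≤ h → v (s + t) = v s + v t)
    {B : ℝ} (hB : ∀ s, 0 ≤ s → s ≤ h → |v s| ≤ B) {s : ℝ} (hs : 0 ≤ s) (hsh : s ≤ h) :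
    v s = s / h * v h := by
  set w : ℝ → ℝ := fun s => v s - s / h * v h with hw
  have wadd : ∀ s t, 0 ≤ s → 0 ≤ t → s + t ≤ h → w (s + t) = w s + w t := by
    intro s t hs ht hst
    simp only [hw, hadd s t hs ht hst]
    ring
  have wh : w h = 0 := by simp [hw, hh.ne']
  have hB0 : 0 ≤ B := (abs_nonneg _).trans (hB 0 le_rfl hh.le)
  -- Doubling: on the lower half of [0, h], w(s) = w(2s) / 2. The upper half reduces to the lower
  -- one because w(h) = 0 gives w(s) = -w(h - s). So any bound on |w| can be halved.
  have key : ∀ n : ℕ, ∀ s, 0 ≤ s → s ≤ h → |w s| ≤ (B + B) * (1 / 2) ^ n := by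
    intro n
    induction n with
    | zero =>
      intro s hs hsh
      have h1 : |s / h * v h| ≤ B := by
        rw [abs_mul, abs_of_nonneg (div_nonneg hs hh.le)]
        calc s / h * |v h| ≤ 1 * B := by
              gcongr
              · exact (div_le_one hh).2 hsh
              · exact hB h hh.le le_rfl
          _ = B := one_mul B
      simpa using (abs_sub _ _).trans (add_le_add (hB s hs hsh) h1)
    | succ n ih =>
      have small : ∀ s, 0 ≤ s → s + s ≤ h → |w s| ≤ (B + B) * (1 / 2) ^ (n + 1) := by
        intro s hs hsh
        have h1 := ih (s + s) (by linarith) hsh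
        rw [wadd s s hs hs hsh, ← two_mul, abs_mul, abs_two] at h1
        rw [pow_succ]
        linarith
      intro s hs hsh
      rcases le_total (s + s) h with h2 | h2
      · exact small s hs h2
      · have h3 := wadd s (h - s) hs (by linarith) (by linarith)
        rw [add_sub_cancel, wh] at h3
        have h4 : w s = -w (h - s) := by linarith
        rw [h4, abs_neg]
        exact small _ (by linarith) (by linarith)
  have hlim : Tendsto (fun n : ℕ => (B + B) * (1 / 2 : ℝ) ^ n) atTop (𝓝 0) := by
    simpa using (tendsto_pow_atTop_nhds_zero_of_lt_one (r := (1 / 2 : ℝ)) (by norm_num)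
      (by norm_num)).const_mul (B + B)
  have h0 : |w s| ≤ 0 := ge_of_tendsto' hlim fun n => key n s hs hsh
  have : w s = 0 := abs_nonpos_iff.1 h0
  simp only [hw] at this
  linarith

/-! ### Independence of a join of σ-algebras -/

namespace ProbabilityTheory

/-- On the π-system of sets A ∩ B generating the join, P(A ∩ B ∩ C) = P(B) P(A ∩ C) = P(B) P(A)
P(C). This adds one increment at a time to an independent family. -/
theorem Indep.sup_left_of_indep_sup {Ω : Type*} {m₁ m₂ m₃ mΩ : MeasurableSpace Ω}
    {μ : Measure Ω} [IsProbabilityMeasure μ] (h₁ : m₁ ≤ mΩ) (h₂ : m₂ ≤ mΩ) (h₃ : m₃ ≤ mΩ)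
    (h13 : Indep m₁ m₃ μ) (h2 : Indep m₂ (m₁ ⊔ m₃) μ) : Indep (m₁ ⊔ m₂) m₃ μ := by
  let S : Set (Set Ω) := {s | ∃ A B, MeasurableSet[m₁] A ∧ MeasurableSet[m₂] B ∧ s = A ∩ B}
  have hS : m₁ ⊔ m₂ = MeasurableSpace.generateFrom S := by
    apply le_antisymm
    · refine sup_le (fun A hA => ?_) (fun B hB => ?_)
      · exact MeasurableSpace.measurableSet_generateFrom
          ⟨A, Set.univ, hA, MeasurableSet.univ, by simp⟩
      · exact MeasurableSpace.measurableSet_generateFrom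
          ⟨Set.univ, B, MeasurableSet.univ, hB, by simp⟩
    · refine MeasurableSpace.generateFrom_le ?_
      rintro _ ⟨A, B, hA, hB, rfl⟩
      exact MeasurableSet.inter (le_sup_left (a := m₁) (b := m₂) _ hA)
        (le_sup_right (a := m₁) (b := m₂) _ hB)
  have hpi : IsPiSystem S := by
    rintro _ ⟨A, B, hA, hB, rfl⟩ _ ⟨A', B', hA', hB', rfl⟩ -
    exact ⟨A ∩ A', B ∩ B', hA.inter hA', hB.inter hB', Set.inter_inter_inter_comm A B A' B'⟩
  refine IndepSets.indep (sup_le h₁ h₂) h₃ hpi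
    (@MeasurableSpace.isPiSystem_measurableSet Ω m₃) hS
    (@MeasurableSpace.generateFrom_measurableSet Ω m₃).symm ?_
  rw [IndepSets_iff]
  rintro _ C ⟨A, B, hA, hB, rfl⟩ hC
  rw [Indep_iff] at h2 h13
  have e1 := h2 B (A ∩ C) hB (MeasurableSet.inter (le_sup_left (a := m₁) (b := m₃) _ hA)
    (le_sup_right (a := m₁) (b := m₃) _ hC))
  have e2 := h2 B A hB (le_sup_left (a := m₁) (b := m₃) _ hA)
  have e3 := h13 A C hA hC
  rw [show A ∩ B ∩ C = B ∩ (A ∩ C) by ext; simp; tauto, Set.inter_comm A B, e1, e2, e3, mul_assoc]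

end ProbabilityTheory

/-! ### The extended logarithm and additive functions with values in [0, ∞] -/

/-- A `[0, ∞]`-valued logarithm for arguments in `[1, ∞]`. -/
noncomputable def logPos (x : ℝ≥0∞) : ℝ≥0∞ := (ENNReal.log x).toENNReal

theorem logPos_one : logPos 1 = 0 := by simp [logPos]

theorem logPos_mono : Monotone logPos := fun _ _ h =>
  EReal.toENNReal_le_toENNReal (ENNReal.log_monotone h)

theorem continuous_logPos : Continuous logPos :=
  EReal.continuous_toENNReal.comp ENNReal.continuous_log

theorem logPos_mul {x y : ℝ≥0∞} (hx : 1 ≤ x) (hy : 1 ≤ y) :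
    logPos (x * y) = logPos x + logPos y := by
  rw [logPos, ENNReal.log_mul_add, EReal.toENNReal_add (ENNReal.zero_le_log_iff.2 hx)
    (ENNReal.zero_le_log_iff.2 hy)]
  rfl

theorem logPos_eq_top_iff {x : ℝ≥0∞} : logPos x = ⊤ ↔ x = ⊤ := by
  simp [logPos, EReal.toENNReal_eq_top_iff]

theorem logPos_ofReal {x : ℝ} (hx : 0 < x) :
    logPos (ENNReal.ofReal x) = ENNReal.ofReal (Real.log x) := by
  rw [logPos, ENNReal.log_ofReal_of_pos hx, EReal.real_coe_toENNReal]

/-- An additive function from `(0, ∞)` to `[0, ∞]` is linear. -/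
theorem eq_ofReal_mul_of_additive {κ : ℝ → ℝ≥0∞}
    (hadd : ∀ s t, 0 < s → 0 < t → κ (s + t) = κ s + κ t) {s : ℝ} (hs : 0 < s) :
    κ s = ENNReal.ofReal s * κ 1 := by
  have hmono : ∀ s t, 0 < s → s ≤ t → κ s ≤ κ t := by
    intro s t hs hst
    rcases hst.eq_or_lt with rfl | h
    · exact le_rfl
    · rw [show t = s + (t - s) by ring, hadd s (t - s) hs (by linarith)]
      exact le_self_add
  have hnat : ∀ (n : ℕ) (s : ℝ), 0 < s → κ ((n + 1 : ℕ) * s) = (n + 1 : ℕ) * κ s := by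
    intro n s hs
    induction n with
    | zero => simp
    | succ n ih =>
      rw [Nat.cast_succ, add_mul, one_mul, hadd _ _ (by positivity) hs, ih, Nat.cast_succ (n + 1),
        add_mul, one_mul]
  have hfin : ∀ s t, 0 < s → 0 < t → κ s ≠ ⊤ → κ t ≠ ⊤ := by
    intro s t hs ht hfin
    obtain ⟨n, hn⟩ := exists_nat_ge (t / s)
    have h1 : t ≤ (n + 1 : ℕ) * s := by
      rw [div_le_iff₀ hs] at hn
      push_cast
      linarith
    refine ne_top_of_le_ne_top ?_ (hmono t _ ht h1)
    rw [hnat n s hs]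
    exact ENNReal.mul_ne_top (ENNReal.natCast_ne_top _) hfin
  -- By monotonicity and multiples, κ is finite everywhere on (0, ∞) or nowhere.
  by_cases h1 : κ 1 = ⊤
  · rw [h1, ENNReal.mul_top (by simpa using hs)]
    by_contra h
    exact hfin s 1 hs one_pos h h1
  · have hf : ∀ t, 0 < t → κ t ≠ ⊤ := fun t ht => hfin 1 t one_pos ht h1
    let v : ℝ → ℝ := fun t => if t ≤ 0 then 0 else (κ t).toReal
    have hv : ∀ t, 0 < t → v t = (κ t).toReal := fun t ht => if_neg ht.not_ge
    have hv0 : v 0 = 0 := if_pos le_rfl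
    have vadd : ∀ s t, 0 ≤ s → 0 ≤ t → v (s + t) = v s + v t := by
      intro s t hs ht
      rcases hs.eq_or_lt with rfl | hs
      · simp [hv0]
      rcases ht.eq_or_lt with rfl | ht
      · simp [hv0]
      rw [hv _ hs, hv _ ht, hv _ (add_pos hs ht), hadd s t hs ht,
        ENNReal.toReal_add (hf s hs) (hf t ht)]
    have vpos : ∀ s, 0 ≤ s → 0 ≤ v s := by
      intro s hs
      rcases hs.eq_or_lt with rfl | hs
      · exact hv0.ge
      · rw [hv s hs]; exact ENNReal.toReal_nonneg
    -- An interval containing both s and 1, so that both values are compared with v(h); monotonicity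
    -- supplies the bound.
    set h := max s 1
    have hh : 0 < h := lt_max_of_lt_right one_pos
    have hb : ∀ s, 0 ≤ s → s ≤ h → |v s| ≤ v h := by
      intro s hs hsh
      have := vadd s (h - s) hs (by linarith)
      rw [add_sub_cancel] at this
      rw [abs_of_nonneg (vpos s hs)]
      linarith [vpos (h - s) (by linarith)]
    have e1 := eq_div_mul_of_additive_of_bounded hh (fun s t hs ht _ => vadd s t hs ht) hb hs.le
      (le_max_left s 1)
    have e2 := eq_div_mul_of_additive_of_bounded hh (fun s t hs ht _ => vadd s t hs ht) hb
      zero_le_one (le_max_right s 1)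
    have e3 : v s = s * v 1 := by
      rw [e1, e2]; ring
    rw [hv s hs, hv 1 one_pos] at e3
    rw [← ENNReal.ofReal_toReal (hf s hs), e3, ENNReal.ofReal_mul hs.le, ENNReal.ofReal_toReal h1]

/-! ### Independence of past and future increments -/

section Independence

variable {Ω : Type*} {k : ℕ}

/-- The σ-algebra generated by the increments `L p - L s`, `p ≤ s`. -/
@[reducible]
def pastIncrements (L : ℝ → Ω → Fin k → ℝ) (s : ℝ) : MeasurableSpace Ω :=
  ⨆ p : Set.Iic s, MeasurableSpace.comap (fun ω => L p ω - L s ω) inferInstance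

/-- The σ-algebra generated by the increments `L p - L s`, `p ≥ s`. -/
@[reducible]
def futureIncrements (L : ℝ → Ω → Fin k → ℝ) (s : ℝ) : MeasurableSpace Ω :=
  ⨆ p : Set.Ici s, MeasurableSpace.comap (fun ω => L p ω - L s ω) inferInstance

theorem measurable_pastIncrements (L : ℝ → Ω → Fin k → ℝ) {p q s : ℝ} (hp : p ≤ s) (hq : q ≤ s) :
    Measurable[pastIncrements L s] (fun ω => L q ω - L p ω) := by
  have h : ∀ r, r ≤ s → Measurable[pastIncrements L s] (fun ω => L r ω - L s ω) := fun r hr =>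
    Measurable.mono (comap_measurable (fun ω => L r ω - L s ω))
      (le_iSup (fun p : Set.Iic s => MeasurableSpace.comap (fun ω => L p ω - L s ω) inferInstance)
        ⟨r, hr⟩) le_rfl
  have := (h q hq).sub (h p hp)
  simpa only [Pi.sub_def, sub_sub_sub_cancel_right] using this

theorem measurable_futureIncrements (L : ℝ → Ω → Fin k → ℝ) {p q s : ℝ} (hp : s ≤ p) (hq : s ≤ q) :
    Measurable[futureIncrements L s] (fun ω => L q ω - L p ω) := by
  have h : ∀ r, s ≤ r → Measurable[futureIncrements L s] (fun ω => L r ω - L s ω) := fun r hr =>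
    Measurable.mono (comap_measurable (fun ω => L r ω - L s ω))
      (le_iSup (fun p : Set.Ici s => MeasurableSpace.comap (fun ω => L p ω - L s ω) inferInstance)
        ⟨r, hr⟩) le_rfl
  have := (h q hq).sub (h p hp)
  simpa only [Pi.sub_def, sub_sub_sub_cancel_right] using this

theorem pastIncrements_le {m : MeasurableSpace Ω} {L : ℝ → Ω → Fin k → ℝ} {s : ℝ}
    (h : ∀ p, p ≤ s → Measurable[m] (fun ω => L p ω - L s ω)) : pastIncrements L s ≤ m :=
  iSup_le fun p => (h p p.2).comap_le

theorem futureIncrements_le {m : MeasurableSpace Ω} {L : ℝ → Ω → Fin k → ℝ} {s : ℝ}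
    (h : ∀ p, s ≤ p → Measurable[m] (fun ω => L p ω - L s ω)) : futureIncrements L s ≤ m :=
  iSup_le fun p => (h p p.2).comap_le

theorem pastIncrements_mono (L : ℝ → Ω → Fin k → ℝ) {s t : ℝ} (hst : s ≤ t) :
    pastIncrements L s ≤ pastIncrements L t :=
  pastIncrements_le fun _ hp => measurable_pastIncrements L hst (hp.trans hst)

variable [mΩ : MeasurableSpace Ω] {Q : Measure Ω} [IsProbabilityMeasure Q]
  {L : ℝ → Ω → Fin k → ℝ}

/-- If each single increment after time `s` is independent of `H s`, then the increments after
time `a` are jointly independent of `H a`. -/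
theorem indep_futureIncrements (hmeas : ∀ t, Measurable (L t)) {a : ℝ} {H : ℝ → MeasurableSpace Ω}
    (hH : ∀ s, H s ≤ mΩ) (hmono : ∀ s, a ≤ s → H a ≤ H s)
    (hadapted : ∀ p s, a ≤ p → p ≤ s → Measurable[H s] (fun ω => L p ω - L a ω))
    (hindep : ∀ s u, a ≤ s → s ≤ u →
      Indep (MeasurableSpace.comap (fun ω => L u ω - L s ω) inferInstance) (H s) Q) :
    Indep (futureIncrements L a) (H a) Q := by
  set c : ℝ → MeasurableSpace Ω := fun p =>
    MeasurableSpace.comap (fun ω => L p ω - L a ω) inferInstance with hc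
  have hcle : ∀ p, c p ≤ mΩ := fun p => ((hmeas p).sub (hmeas a)).comap_le
  have fin : ∀ S : Finset ℝ, (∀ p ∈ S, a ≤ p) → Indep (⨆ p ∈ S, c p) (H a) Q := by
    intro S
    induction S using Finset.induction_on_max with
    | empty =>
      intro _
      simpa using indep_bot_left (H a)
    | insert p S hp ih =>
      intro hS
      have hS' : ∀ q ∈ S, a ≤ q := fun q hq => hS q (Finset.mem_insert_of_mem hq)
      have hap : a ≤ p := hS p (Finset.mem_insert_self _ _)
      -- Take s to be the last of the earlier times, or a if there are none. Then L p - L a = (L p -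
      -- L s) + (L s - L a), where the first term is independent of `H s`, which contains `H a` and
      -- all the earlier increments.
      obtain ⟨s, has, hsp, hSs, hmem⟩ : ∃ s, a ≤ s ∧ s ≤ p ∧ (∀ q ∈ S, q ≤ s) ∧
          (s = a ∨ s ∈ S) := by
        rcases S.eq_empty_or_nonempty with rfl | hne
        · exact ⟨a, le_rfl, hap, by simp, Or.inl rfl⟩
        · exact ⟨S.max' hne, hS' _ (S.max'_mem hne), (hp _ (S.max'_mem hne)).le,
            fun q hq => S.le_max' q hq, Or.inr (S.max'_mem hne)⟩
      have hle : (⨆ q ∈ S, c q) ≤ H s :=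
        iSup₂_le fun q hq => (hadapted q s (hS' q hq) (hSs q hq)).comap_le
      have h2 : Indep (MeasurableSpace.comap (fun ω => L p ω - L s ω) inferInstance)
          ((⨆ q ∈ S, c q) ⊔ H a) Q :=
        indep_of_indep_of_le_right (hindep s p has hsp) (sup_le hle (hmono s has))
      have h3 := Indep.sup_left_of_indep_sup (iSup₂_le fun q _ => hcle q)
        ((hmeas p).sub (hmeas s)).comap_le (hH a) (ih hS') h2
      refine indep_of_indep_of_le_left h3 (iSup₂_le fun q hq => ?_)
      rcases Finset.mem_insert.1 hq with rfl | hq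
      · have e1 : Measurable[(⨆ q ∈ S, c q) ⊔
            MeasurableSpace.comap (fun ω => L q ω - L s ω) inferInstance]
            (fun ω => L q ω - L s ω) :=
          Measurable.mono (comap_measurable (fun ω => L q ω - L s ω)) le_sup_right le_rfl
        have e2 : Measurable[(⨆ q ∈ S, c q) ⊔
            MeasurableSpace.comap (fun ω => L q ω - L s ω) inferInstance]
            (fun ω => L s ω - L a ω) := by
          rcases hmem with rfl | hmem
          · simp
          · exact Measurable.mono (comap_measurable (fun ω => L s ω - L a ω))
              ((le_iSup₂ (f := fun q (_ : q ∈ S) => c q) s hmem).trans le_sup_left) le_rfl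
        have := e1.add e2
        simp only [Pi.add_def, sub_add_sub_cancel] at this
        exact this.comap_le
      · exact (le_iSup₂ (f := fun q (_ : q ∈ S) => c q) q hq).trans le_sup_left
  -- The whole future is the directed union of its finite subfamilies.
  have hdir : Directed (· ≤ ·) fun S : Finset (Set.Ici a) => ⨆ p ∈ S, c p := by
    refine Monotone.directed_le fun S T hST => ?_
    exact biSup_mono fun _ h => hST h
  have h := indep_iSup_of_directed_le (m := fun S : Finset (Set.Ici a) => ⨆ p ∈ S, c p)
    (m1 := H a) (μ := Q) (fun S => ?_) (fun S => iSup₂_le fun p _ => hcle p) (hH a) hdir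
  · refine indep_of_indep_of_le_left h (iSup_le fun p => ?_)
    refine le_iSup_of_le {p} ?_
    simp [hc]
  · classical
    have := fin (S.image Subtype.val) (by simp +contextual)
    refine indep_of_indep_of_le_left this (iSup₂_le fun p hp => ?_)
    exact le_iSup₂ (f := fun q (_ : q ∈ S.image Subtype.val) => c q) p.1
      (Finset.mem_image_of_mem _ hp)

/-- Independent increments are used along monotone sequences. Here finitely many past times are
listed in such a sequence, with the increment from s to u as step n, so that it is independent of
steps 0, ..., n - 1. -/
theorem exists_monotone_seq_of_finset (S : Finset ℝ) (s u : ℝ) (hS : ∀ p ∈ S, p ≤ s)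
    (hsu : s ≤ u) : ∃ (τ : ℕ → ℝ) (n : ℕ), Monotone τ ∧ τ n = s ∧ τ (n + 1) = u ∧
      ∀ p ∈ S, ∃ i ≤ n, τ i = p := by
  induction S using Finset.induction_on_max generalizing s u with
  | empty =>
    refine ⟨fun i => if i = 0 then s else u, 0, ?_, by simp, by simp, by simp⟩
    refine monotone_nat_of_le_succ fun n => ?_
    by_cases h : n = 0 <;> simp [h, hsu]
  | insert p S hp ih =>
    obtain ⟨τ, n, hτ, h1, h2, h3⟩ := ih p s (fun q hq => (hp q hq).le)
      (hS p (Finset.mem_insert_self _ _))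
    refine ⟨fun i => if i ≤ n + 1 then τ i else u, n + 1, ?_, by simp [h2], by simp, ?_⟩
    · refine monotone_nat_of_le_succ fun i => ?_
      rcases lt_trichotomy i (n + 1) with h | h | h
      · simp only [h.le, if_true, Nat.succ_le_of_lt h]
        exact hτ (Nat.le_succ i)
      · subst h
        simpa [h2] using hsu
      · simp [h.not_ge, (h.trans (Nat.lt_succ_self i)).not_ge]
    · intro q hq
      rcases Finset.mem_insert.1 hq with rfl | hq
      · exact ⟨n, n.le_succ, by simp [h1]⟩
      · obtain ⟨i, hi, hiq⟩ := h3 q hq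
        exact ⟨i, hi.trans n.le_succ, by simp [hi.trans n.le_succ, hiq]⟩

theorem indep_pastIncrements (hmeas : ∀ t, Measurable (L t))
    (hL : HasIndepIncrements L Q) {s u : ℝ} (hsu : s ≤ u) :
    Indep (MeasurableSpace.comap (fun ω => L u ω - L s ω) inferInstance)
      (pastIncrements L s) Q := by
  set c : ℝ → MeasurableSpace Ω := fun p =>
    MeasurableSpace.comap (fun ω => L p ω - L s ω) inferInstance with hc
  have hcle : ∀ p, c p ≤ mΩ := fun p => ((hmeas p).sub (hmeas s)).comap_le
  have fin : ∀ S : Finset ℝ, (∀ p ∈ S, p ≤ s) →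
      Indep (⨆ p ∈ S, c p) (MeasurableSpace.comap (fun ω => L u ω - L s ω) inferInstance) Q := by
    intro S hS
    obtain ⟨τ, n, hτ, h1, h2, h3⟩ := exists_monotone_seq_of_finset S s u hS hsu
    have hi := hL.nat hτ
    have hd := indep_iSup_of_disjoint (fun i => ((hmeas (τ (i + 1))).sub (hmeas (τ i))).comap_le)
      hi (S := {i | i < n}) (T := {n}) (by simp)
    rw [iSup_singleton, h1, h2] at hd
    refine indep_of_indep_of_le_left hd (iSup₂_le fun p hp => ?_)
    obtain ⟨i, hin, rfl⟩ := h3 p hp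
    set m := ⨆ i ∈ {i | i < n}, MeasurableSpace.comap (fun ω => L (τ (i + 1)) ω - L (τ i) ω)
      inferInstance with hm
    have hincr : ∀ j, j < n → Measurable[m] (fun ω => L (τ (j + 1)) ω - L (τ j) ω) := fun j hj =>
      Measurable.mono (comap_measurable (fun ω => L (τ (j + 1)) ω - L (τ j) ω))
        (le_iSup₂ (f := fun i (_ : i ∈ {i | i < n}) => MeasurableSpace.comap
          (fun ω => L (τ (i + 1)) ω - L (τ i) ω) inferInstance) j hj) le_rfl
    -- Telescoping recovers L s - L p from the steps before n.
    have : ∀ j, i ≤ j → j ≤ n → Measurable[m] (fun ω => L (τ j) ω - L (τ i) ω) := by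
      intro j hij
      induction j, hij using Nat.le_induction with
      | base => intro _; simp
      | succ j hij ih =>
        intro hj
        have := (hincr j hj).add (ih (Nat.le_of_succ_le hj))
        simpa only [Pi.add_def, sub_add_sub_cancel] using this
    have := (this n hin le_rfl).neg
    simp only [Pi.neg_def, neg_sub, h1] at this
    exact this.comap_le
  have hdir : Directed (· ≤ ·) fun S : Finset (Set.Iic s) => ⨆ p ∈ S, c p := by
    refine Monotone.directed_le fun S T hST => ?_
    exact biSup_mono fun _ h => hST h
  have h := indep_iSup_of_directed_le (m := fun S : Finset (Set.Iic s) => ⨆ p ∈ S, c p)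
    (m1 := MeasurableSpace.comap (fun ω => L u ω - L s ω) inferInstance) (μ := Q)
    (fun S => ?_) (fun S => iSup₂_le fun p _ => hcle p) ((hmeas u).sub (hmeas s)).comap_le hdir
  · refine (indep_of_indep_of_le_left h (iSup_le fun p => ?_)).symm
    refine le_iSup_of_le {p} ?_
    simp [hc]
  · classical
    have := fin (S.image Subtype.val) (by simp +contextual)
    refine indep_of_indep_of_le_left this (iSup₂_le fun p hp => ?_)
    exact le_iSup₂ (f := fun q (_ : q ∈ S.image Subtype.val) => c q) p.1
      (Finset.mem_image_of_mem _ hp)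

theorem IsTwoSidedLevy.indep_future_past (hL : IsTwoSidedLevy Q L) (a : ℝ) :
    Indep (futureIncrements L a) (pastIncrements L a) Q :=
  indep_futureIncrements hL.measurable (H := pastIncrements L)
    (fun s => pastIncrements_le fun p _ => (hL.measurable p).sub (hL.measurable s))
    (fun _ hs => pastIncrements_mono L hs)
    (fun _ _ hap hps => measurable_pastIncrements L (hap.trans hps) hps)
    (fun _ _ _ hsu => indep_pastIncrements hL.measurable hL.indep_increments hsu)

/-- The filtration only gives independence of one increment at a time. The induction over finite
families is reused with `H s` the σ-algebra at time `s.toNNReal`. -/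
theorem IsLevyFiltration.indep_future {ℱ : Filtration ℝ≥0 mΩ} (hL : ∀ t, Measurable (L t))
    (hLℱ : IsLevyFiltration Q ℱ L) (t : ℝ≥0) : Indep (futureIncrements L t) (ℱ t) Q := by
  have := indep_futureIncrements (Q := Q) hL (a := t) (H := fun s => ℱ s.toNNReal)
    (fun s => ℱ.le _) (fun s hs => ℱ.mono (Real.toNNReal_mono hs)) ?_ ?_
  · simpa using this
  · intro p s hp hps
    have hs : (0 : ℝ) ≤ s := t.2.trans (hp.trans hps)
    exact (hLℱ.adapted s.toNNReal p (by rwa [Real.coe_toNNReal s hs])).sub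
      (hLℱ.adapted s.toNNReal t (by rw [Real.coe_toNNReal s hs]; exact hp.trans hps))
  · intro s u hs hsu
    have hs0 : (0 : ℝ) ≤ s := t.2.trans hs
    have := hLℱ.indep s.toNNReal u.toNNReal (Real.toNNReal_mono hsu)
    rwa [Real.coe_toNNReal s hs0, Real.coe_toNNReal u (hs0.trans hsu)] at this

end Independence

/-! ### Covariance of increments -/

section Covariance

variable {Ω : Type*} {k : ℕ}

/-- The increment `cᵀ (L q - L p)`. -/
def incr (L : ℝ → Ω → Fin k → ℝ) (c : Fin k → ℝ) (p q : ℝ) (ω : Ω) : ℝ :=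
  c ⬝ᵥ (L q ω - L p ω)

theorem measurable_dotProduct_left (c : Fin k → ℝ) : Measurable fun x : Fin k → ℝ => c ⬝ᵥ x := by
  unfold dotProduct
  fun_prop

theorem measurable_incr {m : MeasurableSpace Ω} {L : ℝ → Ω → Fin k → ℝ} {p q : ℝ}
    (h : Measurable[m] fun ω => L q ω - L p ω) (c : Fin k → ℝ) : Measurable[m] (incr L c p q) :=
  (measurable_dotProduct_left c).comp h

theorem incr_add_incr (L : ℝ → Ω → Fin k → ℝ) (c : Fin k → ℝ) (p q r : ℝ) (ω : Ω) :
    incr L c p q ω + incr L c q r ω = incr L c p r ω := by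
  simp only [incr, ← dotProduct_add]
  congr 1
  abel

theorem abs_dotProduct_le (c x : Fin k → ℝ) : |c ⬝ᵥ x| ≤ k * (‖c‖ * ‖x‖) := by
  calc |c ⬝ᵥ x| ≤ ∑ i, |c i * x i| := Finset.abs_sum_le_sum_abs _ _
    _ ≤ ∑ _i : Fin k, ‖c‖ * ‖x‖ := by
        refine Finset.sum_le_sum fun i _ => ?_
        rw [abs_mul]
        exact mul_le_mul (norm_le_pi_norm c i) (norm_le_pi_norm x i) (abs_nonneg _) (norm_nonneg _)
    _ = _ := by simp

variable [mΩ : MeasurableSpace Ω] {Q : Measure Ω} [IsProbabilityMeasure Q]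
  {L : ℝ → Ω → Fin k → ℝ}

theorem ProbabilityTheory.Indep.indepFun {m₁ m₂ : MeasurableSpace Ω} (h : Indep m₁ m₂ Q)
    {β γ : Type*} [MeasurableSpace β] [MeasurableSpace γ] {f : Ω → β} {g : Ω → γ}
    (hf : Measurable[m₁] f) (hg : Measurable[m₂] g) : IndepFun f g Q :=
  (IndepFun_iff_Indep f g Q).2
    (indep_of_indep_of_le_left (indep_of_indep_of_le_right h hg.comap_le) hf.comap_le)

theorem IsTwoSidedLevy.indepFun_incr (hL : IsTwoSidedLevy Q L) (c c' : Fin k → ℝ)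
    {p q s p' q' : ℝ} (hp : p ≤ s) (hq : q ≤ s) (hp' : s ≤ p') (hq' : s ≤ q') :
    IndepFun (incr L c p q) (incr L c' p' q') Q :=
  ((hL.indep_future_past s).indepFun
    (measurable_incr (measurable_futureIncrements L hp' hq') c')
    (measurable_incr (measurable_pastIncrements L hp hq) c)).symm

theorem IsTwoSidedLevy.measurable_incr (hL : IsTwoSidedLevy Q L) (c : Fin k → ℝ) (p q : ℝ) :
    Measurable (incr L c p q) :=
  _root_.measurable_incr ((hL.measurable q).sub (hL.measurable p)) c

theorem memLp_dotProduct {X : Ω → Fin k → ℝ} (hX : MemLp X 2 Q) (c : Fin k → ℝ) :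
    MemLp (fun ω => c ⬝ᵥ X ω) 2 Q := by
  unfold dotProduct
  exact memLp_finsetSum _ fun i _ => (MemLp.eval hX i).const_mul (c i)

theorem memLp_incr (hsq : ∀ t, MemLp (L t) 2 Q) (c : Fin k → ℝ) (p q : ℝ) :
    MemLp (incr L c p q) 2 Q :=
  memLp_dotProduct ((hsq q).sub (hsq p)) c

theorem integral_incr (hsq : ∀ t, MemLp (L t) 2 Q) (hmean : ∀ t, ∫ ω, L t ω ∂Q = 0)
    (c : Fin k → ℝ) (p q : ℝ) : ∫ ω, incr L c p q ω ∂Q = 0 := by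
  have hint : ∀ t i, Integrable (fun ω => L t ω i) Q := fun t i =>
    (MemLp.eval (hsq t) i).integrable (by norm_num)
  have h0 : ∀ t i, ∫ ω, L t ω i ∂Q = 0 := by
    intro t i
    rw [← eval_integral (fun i => hint t i) i, hmean t]
    rfl
  simp only [incr, dotProduct, Pi.sub_apply]
  rw [integral_finsetSum (f := fun i ω => c i * (L q ω i - L p ω i)) _
    fun i _ => ((hint q i).sub (hint p i)).const_mul _]
  refine Finset.sum_eq_zero fun i _ => ?_
  rw [integral_const_mul, integral_sub (hint q i) (hint p i), h0, h0]
  simp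

theorem integrable_incr_mul_incr (hsq : ∀ t, MemLp (L t) 2 Q) (c c' : Fin k → ℝ) (p q p' q' : ℝ) :
    Integrable (fun ω => incr L c p q ω * incr L c' p' q' ω) Q :=
  (memLp_incr hsq c p q).integrable_mul (memLp_incr hsq c' p' q')

theorem IsTwoSidedLevy.integral_incr_mul_incr_of_le (hL : IsTwoSidedLevy Q L)
    (hsq : ∀ t, MemLp (L t) 2 Q) (hmean : ∀ t, ∫ ω, L t ω ∂Q = 0) (c c' : Fin k → ℝ)
    {p q p' q' : ℝ} (hpq : p ≤ q) (hqp : q ≤ p') (hpq' : p' ≤ q') :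
    ∫ ω, incr L c p q ω * incr L c' p' q' ω ∂Q = 0 := by
  rw [(hL.indepFun_incr c c' hpq le_rfl hqp (hqp.trans hpq')).integral_fun_mul_eq_mul_integral
    (hL.measurable_incr c p q).aestronglyMeasurable
    (hL.measurable_incr c' p' q').aestronglyMeasurable, integral_incr hsq hmean, zero_mul]

/-- The covariance of `cᵀ L(1)` and `c'ᵀ L(1)`. -/
noncomputable def incrCov (Q : Measure Ω) (L : ℝ → Ω → Fin k → ℝ) (c c' : Fin k → ℝ) : ℝ :=
  ∫ ω, incr L c 0 1 ω * incr L c' 0 1 ω ∂Q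

theorem IsTwoSidedLevy.identDistrib_sub (hL : IsTwoSidedLevy Q L) {p q : ℝ} (hpq : p ≤ q) :
    IdentDistrib (fun ω => L q ω - L p ω) (L (q - p)) Q Q := by
  simpa using hL.stationary_increments p (q - p) (sub_nonneg.2 hpq)

/-- By stationarity the covariance depends only on the length of the interval, and it is additive in
that length because increments over adjacent intervals are uncorrelated. Being locally bounded, it
is linear. -/
theorem IsTwoSidedLevy.integral_incr_mul_incr_self (hL : IsTwoSidedLevy Q L)
    (hsq : ∀ t, MemLp (L t) 2 Q) (hmean : ∀ t, ∫ ω, L t ω ∂Q = 0) (c c' : Fin k → ℝ)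
    {p q : ℝ} (hpq : p ≤ q) :
    ∫ ω, incr L c p q ω * incr L c' p q ω ∂Q = (q - p) * incrCov Q L c c' := by
  let V : (Fin k → ℝ) → (Fin k → ℝ) → ℝ → ℝ := fun c c' s => ∫ ω, (c ⬝ᵥ L s ω) * (c' ⬝ᵥ L s ω) ∂Q
  have hV : ∀ c c' p q, p ≤ q → ∫ ω, incr L c p q ω * incr L c' p q ω ∂Q = V c c' (q - p) := by
    intro c c' p q hpq
    exact ((hL.identDistrib_sub hpq).comp
      ((measurable_dotProduct_left c).mul (measurable_dotProduct_left c'))).integral_eq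
  have hadd : ∀ c c' s t, 0 ≤ s → 0 ≤ t → V c c' (s + t) = V c c' s + V c c' t := by
    intro c c' s t hs ht
    have e1 := hV c c' 0 (s + t) (by linarith)
    have e2 := hV c c' 0 s hs
    have e3 := hV c c' s (s + t) (by linarith)
    rw [sub_zero] at e1 e2
    rw [add_sub_cancel_left] at e3
    rw [← e1, ← e2, ← e3]
    have e4 := hL.integral_incr_mul_incr_of_le hsq hmean c c' hs le_rfl
      (show s ≤ s + t by linarith)
    have e5 := hL.integral_incr_mul_incr_of_le hsq hmean c' c hs le_rfl
      (show s ≤ s + t by linarith)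
    have : ∀ ω, incr L c 0 (s + t) ω * incr L c' 0 (s + t) ω =
        (incr L c 0 s ω * incr L c' 0 s ω + incr L c s (s + t) ω * incr L c' s (s + t) ω) +
        (incr L c 0 s ω * incr L c' s (s + t) ω + incr L c' 0 s ω * incr L c s (s + t) ω) := by
      intro ω
      rw [← incr_add_incr L c 0 s (s + t), ← incr_add_incr L c' 0 s (s + t)]
      ring
    simp_rw [this]
    rw [integral_add, integral_add, integral_add, e4, e5]
    · ring
    all_goals
      first
      | exact integrable_incr_mul_incr hsq _ _ _ _ _ _
      | exact (integrable_incr_mul_incr hsq _ _ _ _ _ _).add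
          (integrable_incr_mul_incr hsq _ _ _ _ _ _)
  have hpos : ∀ c s, 0 ≤ V c c s := fun c s => integral_nonneg fun ω => mul_self_nonneg _
  have hint : ∀ c c' s, Integrable (fun ω => (c ⬝ᵥ L s ω) * (c' ⬝ᵥ L s ω)) Q := fun c c' s =>
    (memLp_dotProduct (hsq s) c).integrable_mul (memLp_dotProduct (hsq s) c')
  -- The mixed term is bounded through |xy| ≤ x² + y² by two variances, which increase with time
  -- since they are additive and nonnegative.
  have hbd : ∀ h s, 0 ≤ s → s ≤ h → |V c c' s| ≤ V c c h + V c' c' h := by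
    intro h s hs hsh
    have e1 := hadd c c s (h - s) hs (by linarith)
    have e2 := hadd c' c' s (h - s) hs (by linarith)
    rw [add_sub_cancel] at e1 e2
    have e3 : |V c c' s| ≤ V c c s + V c' c' s := by
      simp only [V]
      rw [← integral_add (hint c c s) (hint c' c' s)]
      refine (abs_integral_le_integral_abs).trans (integral_mono (hint c c' s).abs
        ((hint c c s).add (hint c' c' s)) fun ω => ?_)
      rw [abs_le]
      constructor <;> nlinarith [sq_nonneg (c ⬝ᵥ L s ω + c' ⬝ᵥ L s ω),
        sq_nonneg (c ⬝ᵥ L s ω - c' ⬝ᵥ L s ω), sq_nonneg (c ⬝ᵥ L s ω), sq_nonneg (c' ⬝ᵥ L s ω)]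
    linarith [hpos c (h - s), hpos c' (h - s)]
  have hcov : incrCov Q L c c' = V c c' 1 := by
    rw [incrCov, hV c c' 0 1 zero_le_one, sub_zero]
  rw [hV c c' p q hpq, hcov]
  set s := q - p
  have hs : 0 ≤ s := sub_nonneg.2 hpq
  have hh : 0 < max s 1 := lt_max_of_lt_right one_pos
  rw [eq_div_mul_of_additive_of_bounded hh (fun s t hs ht _ => hadd c c' s t hs ht) (hbd _) hs
    (le_max_left s 1), eq_div_mul_of_additive_of_bounded hh
    (fun s t hs ht _ => hadd c c' s t hs ht) (hbd _) zero_le_one (le_max_right s 1)]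
  ring

/-- Only the overlap of the two intervals contributes. The cases are the two disjoint positions and
the four orders of the endpoints of overlapping intervals. -/
theorem IsTwoSidedLevy.integral_incr_mul_incr (hL : IsTwoSidedLevy Q L)
    (hsq : ∀ t, MemLp (L t) 2 Q) (hmean : ∀ t, ∫ ω, L t ω ∂Q = 0) (c c' : Fin k → ℝ)
    {a b a' b' : ℝ} (hab : a ≤ b) (hab' : a' ≤ b') :
    ∫ ω, incr L c a b ω * incr L c' a' b' ω ∂Q =
      max (min b b' - max a a') 0 * incrCov Q L c c' := by
  have I := fun c c' p q p' q' => integrable_incr_mul_incr (Q := Q) hsq c c' p q p' q'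
  have addl : ∀ c c' p q r p' q', ∫ ω, incr L c p r ω * incr L c' p' q' ω ∂Q =
      ∫ ω, incr L c p q ω * incr L c' p' q' ω ∂Q +
      ∫ ω, incr L c q r ω * incr L c' p' q' ω ∂Q := by
    intro c c' p q r p' q'
    rw [← integral_add (I _ _ _ _ _ _) (I _ _ _ _ _ _)]
    simp_rw [← add_mul, incr_add_incr]
  have comm : ∀ c c' p q p' q', ∫ ω, incr L c p q ω * incr L c' p' q' ω ∂Q =
      ∫ ω, incr L c' p' q' ω * incr L c p q ω ∂Q := by
    intro c c' p q p' q'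
    simp_rw [mul_comm]
  have addr : ∀ c c' p q r p' q', ∫ ω, incr L c p' q' ω * incr L c' p r ω ∂Q =
      ∫ ω, incr L c p' q' ω * incr L c' p q ω ∂Q +
      ∫ ω, incr L c p' q' ω * incr L c' q r ω ∂Q := by
    intro c c' p q r p' q'
    rw [comm, addl c' c p q r, comm c', comm c']
  have Z := fun c c' => @IsTwoSidedLevy.integral_incr_mul_incr_of_le _ _ _ Q _ L hL hsq hmean c c'
  have D := fun c c' => @IsTwoSidedLevy.integral_incr_mul_incr_self _ _ _ Q _ L hL hsq hmean c c'
  have Z' : ∀ c c' {p q p' q'}, p' ≤ q' → q' ≤ p → p ≤ q →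
      ∫ ω, incr L c p q ω * incr L c' p' q' ω ∂Q = 0 := fun c c' p q p' q' h1 h2 h3 => by
    rw [comm, Z c' c h1 h2 h3]
  rcases le_total b a' with h | h
  · rw [Z c c' hab h hab', max_eq_right, zero_mul]
    linarith [min_le_left b b', le_max_right a a']
  rcases le_total b' a with h' | h'
  · rw [Z' c c' hab' h' hab, max_eq_right, zero_mul]
    linarith [min_le_right b b', le_max_left a a']
  rcases le_total a a' with h1 | h1 <;> rcases le_total b b' with h2 | h2
  · rw [min_eq_left h2, max_eq_right h1, max_eq_left (by linarith), addl c c' a a' b,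
      Z c c' h1 le_rfl hab', addr c c' a' b b', Z c c' h le_rfl h2, D c c' h]
    ring
  · rw [min_eq_right h2, max_eq_right h1, max_eq_left (by linarith), addl c c' a a' b,
      Z c c' h1 le_rfl hab', addl c c' a' b' b, Z' c c' hab' le_rfl h2, D c c' hab']
    ring
  · rw [min_eq_left h2, max_eq_left h1, max_eq_left (by linarith), addr c c' a' a b',
      Z' c c' h1 le_rfl hab, addr c c' a b b', Z c c' hab le_rfl h2, D c c' hab]
    ring
  · rw [min_eq_right h2, max_eq_left h1, max_eq_left (by linarith), addr c c' a' a b',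
      Z' c c' h1 le_rfl hab, addl c c' a b' b, Z' c c' h' le_rfl h2, D c c' h']
    ring

end Covariance

/-! ### Comparison of L² norms and measurability of L² limits -/

theorem eLpNorm_two_le_of_integral_sq_le {α β E F : Type*} [MeasurableSpace α] [MeasurableSpace β]
    [NormedAddCommGroup E] [NormedAddCommGroup F] {μ : Measure α} {ν : Measure β}
    {f : α → E} {g : β → F} (hf : MemLp f 2 μ) (hg : MemLp g 2 ν) {C : ℝ} (hC : 0 ≤ C)
    (h : ∫ x, ‖f x‖ ^ 2 ∂μ ≤ C ^ 2 * ∫ x, ‖g x‖ ^ 2 ∂ν) :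
    eLpNorm f 2 μ ≤ ENNReal.ofReal C * eLpNorm g 2 ν := by
  rw [hf.eLpNorm_eq_integral_rpow_norm (by norm_num) (by norm_num),
    hg.eLpNorm_eq_integral_rpow_norm (by norm_num) (by norm_num), ← ENNReal.ofReal_mul hC]
  refine ENNReal.ofReal_le_ofReal ?_
  simp only [ENNReal.toReal_ofNat, Real.rpow_ofNat]
  have h2 : ∀ x : ℝ, x ^ (2⁻¹ : ℝ) = √x := fun x => by rw [Real.sqrt_eq_rpow]; norm_num
  rw [h2, h2]
  calc √(∫ x, ‖f x‖ ^ 2 ∂μ) ≤ √(C ^ 2 * ∫ x, ‖g x‖ ^ 2 ∂ν) := Real.sqrt_le_sqrt h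
    _ = _ := by rw [Real.sqrt_mul (sq_nonneg C), Real.sqrt_sq hC]

/-- An `L²`-limit of `m`-measurable functions is almost everywhere `m`-measurable. -/
theorem aestronglyMeasurable_of_tendsto_eLpNorm {Ω : Type*} {m mΩ : MeasurableSpace Ω}
    {Q : Measure Ω} (hm : m ≤ mΩ) {J : ℕ → Ω → ℝ} {I : Ω → ℝ} (hI : AEStronglyMeasurable I Q)
    (hJ : ∀ n, Measurable[m] (J n))
    (h : Tendsto (fun n => eLpNorm (fun ω => J n ω - I ω) 2 Q) atTop (𝓝 0)) :
    AEStronglyMeasurable[m] I Q := by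
  have h1 : TendstoInMeasure Q J atTop I :=
    tendstoInMeasure_of_tendsto_eLpNorm (p := 2) (by norm_num)
      (fun n => ((hJ n).mono hm le_rfl).aestronglyMeasurable) hI h
  obtain ⟨ns, -, hns⟩ := h1.exists_seq_tendsto_ae
  -- The limsup of an a.s. convergent subsequence is an `m`-measurable version of the limit.
  refine ⟨fun ω => limsup (fun n => J (ns n) ω) atTop, ?_, ?_⟩
  · exact (Measurable.limsup fun n => hJ (ns n)).stronglyMeasurable
  · filter_upwards [hns] with ω hω using hω.limsup_eq.symm

/-! ### Step functions and the Itô isometry -/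

namespace StepFunction

variable {k : ℕ}

/-- The sum of two step functions. -/
def add (φ χ : StepFunction k) : StepFunction k where
  n := φ.n + χ.n
  a := Fin.append φ.a χ.a
  b := Fin.append φ.b χ.b
  a_le_b i := by
    refine Fin.addCases (fun i => ?_) (fun i => ?_) i
    · simpa using φ.a_le_b i
    · simpa using χ.a_le_b i
  c := Fin.append φ.c χ.c

/-- A scalar multiple of a step function. -/
def smul (r : ℝ) (φ : StepFunction k) : StepFunction k where
  n := φ.n
  a := φ.a
  b := φ.b
  a_le_b := φ.a_le_b
  c i := r • φ.c i

/-- The restriction of a step function to `(-∞, x]`. -/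
def below (φ : StepFunction k) (x : ℝ) : StepFunction k where
  n := φ.n
  a i := min (φ.a i) x
  b i := min (φ.b i) x
  a_le_b i := min_le_min_right x (φ.a_le_b i)
  c := φ.c

/-- The restriction of a step function to `(x, ∞)`. -/
def above (φ : StepFunction k) (x : ℝ) : StepFunction k where
  n := φ.n
  a i := max (φ.a i) x
  b i := max (φ.b i) x
  a_le_b i := max_le_max_right x (φ.a_le_b i)
  c := φ.c

/-- The step function `c 1_{(p, q]}`. -/
def single {p q : ℝ} (hpq : p ≤ q) (c : Fin k → ℝ) : StepFunction k where
  n := 1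
  a _ := p
  b _ := q
  a_le_b _ := hpq
  c _ := c

theorem eval_add (φ χ : StepFunction k) (s : ℝ) : (φ.add χ).eval s = φ.eval s + χ.eval s := by
  refine (Fin.sum_univ_add (a := φ.n) (b := χ.n) _).trans ?_
  simp only [eval, add, Fin.append_left, Fin.append_right]

theorem eval_smul (r : ℝ) (φ : StepFunction k) (s : ℝ) : (φ.smul r).eval s = r • φ.eval s := by
  simp only [eval, smul, Finset.smul_sum]
  refine Finset.sum_congr rfl fun i _ => ?_
  by_cases h : s ∈ Set.Ioc (φ.a i) (φ.b i) <;> simp [h]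

theorem eval_below (φ : StepFunction k) (x s : ℝ) :
    (φ.below x).eval s = (Set.Iic x).indicator φ.eval s := by
  have : ∀ i, Set.Ioc (min (φ.a i) x) (min (φ.b i) x) = Set.Iic x ∩ Set.Ioc (φ.a i) (φ.b i) := by
    intro i
    ext y
    simp only [Set.mem_Ioc, Set.mem_inter_iff, Set.mem_Iic, min_lt_iff, le_min_iff]
    constructor
    · rintro ⟨h1 | h1, h2, h3⟩
      · exact ⟨h3, h1, h2⟩
      · exact absurd h3 h1.not_ge
    · rintro ⟨h1, h2, h3⟩
      exact ⟨Or.inl h2, h3, h1⟩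
  simp only [eval, below, this]
  by_cases h : s ∈ Set.Iic x
  · simp only [Set.indicator_apply, Set.mem_inter_iff, h, true_and, if_true, eval]
    rfl
  · simp [h]

theorem eval_above (φ : StepFunction k) (x s : ℝ) :
    (φ.above x).eval s = (Set.Ioi x).indicator φ.eval s := by
  have : ∀ i, Set.Ioc (max (φ.a i) x) (max (φ.b i) x) = Set.Ioi x ∩ Set.Ioc (φ.a i) (φ.b i) := by
    intro i
    ext y
    simp only [Set.mem_Ioc, Set.mem_inter_iff, Set.mem_Ioi, max_lt_iff, le_max_iff]
    constructor
    · rintro ⟨⟨h1, h2⟩, h3 | h3⟩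
      · exact ⟨h2, h1, h3⟩
      · exact absurd h3 h2.not_ge
    · rintro ⟨h1, h2, h3⟩
      exact ⟨⟨h2, h1⟩, Or.inl h3⟩
  simp only [eval, above, this]
  by_cases h : s ∈ Set.Ioi x
  · simp only [Set.indicator_apply, Set.mem_inter_iff, h, true_and, if_true, eval]
    rfl
  · simp [h]

theorem eval_single {p q : ℝ} (hpq : p ≤ q) (c : Fin k → ℝ) (s : ℝ) :
    (single hpq c).eval s = (Set.Ioc p q).indicator (fun _ => c) s := by
  exact Fin.sum_univ_one fun _ => (Set.Ioc p q).indicator (fun _ => c) s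

theorem memLp_eval (φ : StepFunction k) (p : ℝ≥0∞) : MemLp φ.eval p volume := by
  unfold eval
  exact memLp_finsetSum _ fun i _ => memLp_indicator_const p measurableSet_Ioc _
    (Or.inr (by simp))

variable {Ω : Type*} {L : ℝ → Ω → Fin k → ℝ}

theorem integral_eq_sum_incr (φ : StepFunction k) (ω : Ω) :
    φ.integral L ω = ∑ i, incr L (φ.c i) (φ.a i) (φ.b i) ω := rfl

theorem integral_add (φ χ : StepFunction k) (ω : Ω) :
    (φ.add χ).integral L ω = φ.integral L ω + χ.integral L ω := by
  refine (Fin.sum_univ_add (a := φ.n) (b := χ.n) _).trans ?_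
  simp only [integral, add, Fin.append_left, Fin.append_right]

theorem integral_smul (r : ℝ) (φ : StepFunction k) (ω : Ω) :
    (φ.smul r).integral L ω = r * φ.integral L ω := by
  simp only [integral, smul, Finset.mul_sum, smul_dotProduct, smul_eq_mul]
  rfl

theorem integral_single {p q : ℝ} (hpq : p ≤ q) (c : Fin k → ℝ) (ω : Ω) :
    (single hpq c).integral L ω = incr L c p q ω := by
  exact Fin.sum_univ_one fun _ => incr L c p q ω

theorem measurable_integral {m : MeasurableSpace Ω} (φ : StepFunction k)
    (h : ∀ i, Measurable[m] fun ω => L (φ.b i) ω - L (φ.a i) ω) :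
    Measurable[m] (φ.integral L) := by
  have : φ.integral L = fun ω => ∑ i, incr L (φ.c i) (φ.a i) (φ.b i) ω := rfl
  rw [this]
  exact Finset.measurable_sum _ fun i _ => measurable_incr (h i) _

variable [mΩ : MeasurableSpace Ω] {Q : Measure Ω} [IsProbabilityMeasure Q]

theorem memLp_integral (hsq : ∀ t, MemLp (L t) 2 Q) (φ : StepFunction k) :
    MemLp (φ.integral L) 2 Q := by
  have : φ.integral L = fun ω => ∑ i, incr L (φ.c i) (φ.a i) (φ.b i) ω := rfl
  rw [this]
  exact memLp_finsetSum _ fun i _ => memLp_incr hsq _ _ _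

theorem integral_integral (hsq : ∀ t, MemLp (L t) 2 Q) (hmean : ∀ t, ∫ ω, L t ω ∂Q = 0)
    (φ : StepFunction k) : ∫ ω, φ.integral L ω ∂Q = 0 := by
  simp only [integral_eq_sum_incr]
  rw [integral_finsetSum _ fun i _ => (memLp_incr hsq _ _ _).integrable (by norm_num)]
  exact Finset.sum_eq_zero fun i _ => integral_incr hsq hmean _ _ _

theorem integral_indicator_mul_indicator {a b a' b' : ℝ} :
    ∫ s, (Set.Ioc a b).indicator (fun _ => (1 : ℝ)) s * (Set.Ioc a' b').indicator (fun _ => 1) s =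
      max (min b b' - max a a') 0 := by
  have : ∀ s, (Set.Ioc a b).indicator (fun _ => (1 : ℝ)) s *
      (Set.Ioc a' b').indicator (fun _ => 1) s =
      (Set.Ioc (max a a') (min b b')).indicator (fun _ => 1) s := by
    intro s
    rw [← Set.inter_indicator_mul, Set.Ioc_inter_Ioc]
    simp
  simp_rw [this]
  rw [MeasureTheory.integral_indicator measurableSet_Ioc]
  simp [Measure.real, ENNReal.toReal_ofReal']

/-- The Itô isometry for step functions. -/
theorem integral_sq_integral (hL : IsTwoSidedLevy Q L)
    (hsq : ∀ t, MemLp (L t) 2 Q) (hmean : ∀ t, ∫ ω, L t ω ∂Q = 0) (φ : StepFunction k) :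
    ∫ ω, φ.integral L ω ^ 2 ∂Q = ∫ s, incrCov Q L (φ.eval s) (φ.eval s) := by
  set e : Fin φ.n → ℝ → ℝ := fun i => (Set.Ioc (φ.a i) (φ.b i)).indicator (fun _ => (1 : ℝ)) with he
  have lhs : ∫ ω, φ.integral L ω ^ 2 ∂Q =
      ∑ i, ∑ j, (∫ s, e i s * e j s) * incrCov Q L (φ.c i) (φ.c j) := by
    simp only [integral_eq_sum_incr, sq, Finset.sum_mul_sum]
    rw [integral_finsetSum _ fun i _ => integrable_finsetSum _ fun j _ =>
      integrable_incr_mul_incr hsq _ _ _ _ _ _]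
    refine Finset.sum_congr rfl fun i _ => ?_
    rw [integral_finsetSum _ fun j _ => integrable_incr_mul_incr hsq _ _ _ _ _ _]
    refine Finset.sum_congr rfl fun j _ => ?_
    rw [hL.integral_incr_mul_incr hsq hmean _ _ (φ.a_le_b i) (φ.a_le_b j),
      integral_indicator_mul_indicator]
  have rhs : ∀ s, incrCov Q L (φ.eval s) (φ.eval s) =
      ∑ i, ∑ j, (e i s * e j s) * incrCov Q L (φ.c i) (φ.c j) := by
    intro s
    have h1 : ∀ ω, incr L (φ.eval s) 0 1 ω = ∑ i, e i s * incr L (φ.c i) 0 1 ω := by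
      intro ω
      simp only [incr, eval, sum_dotProduct]
      refine Finset.sum_congr rfl fun i _ => ?_
      by_cases h : s ∈ Set.Ioc (φ.a i) (φ.b i) <;> simp [he, h]
    simp only [incrCov, h1, Finset.sum_mul_sum]
    have h2 : ∀ i j ω, e i s * incr L (φ.c i) 0 1 ω * (e j s * incr L (φ.c j) 0 1 ω) =
        (e i s * e j s) * (incr L (φ.c i) 0 1 ω * incr L (φ.c j) 0 1 ω) := by
      intros; ring
    simp only [h2]
    rw [integral_finsetSum _ fun i _ => integrable_finsetSum _ fun j _ =>
      (integrable_incr_mul_incr hsq _ _ _ _ _ _).const_mul _]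
    refine Finset.sum_congr rfl fun i _ => ?_
    rw [integral_finsetSum _ fun j _ => (integrable_incr_mul_incr hsq _ _ _ _ _ _).const_mul _]
    exact Finset.sum_congr rfl fun j _ => integral_const_mul _ _
  have hint : ∀ i j, Integrable (fun s => e i s * e j s) volume := by
    intro i j
    have h : ∀ i, MemLp (e i) 2 volume := fun i =>
      memLp_indicator_const 2 measurableSet_Ioc _ (Or.inr (by simp))
    exact (h i).integrable_mul (h j)
  simp only [lhs, rhs]
  rw [integral_finsetSum _ fun i _ => integrable_finsetSum _ fun j _ => (hint i j).mul_const _]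
  refine Finset.sum_congr rfl fun i _ => ?_
  rw [integral_finsetSum _ fun j _ => (hint i j).mul_const _]
  exact Finset.sum_congr rfl fun j _ => (integral_mul_const _ _).symm

/-- The isometry together with Var(cᵀ L(1)) ≤ k² D ‖c‖², where D is the second moment of ‖L(1) -
L(0)‖. The factor k appears because the norm on ℝᵏ is the sup norm. -/
theorem exists_eLpNorm_integral_le (hL : IsTwoSidedLevy Q L)
    (hsq : ∀ t, MemLp (L t) 2 Q) (hmean : ∀ t, ∫ ω, L t ω ∂Q = 0) :
    ∃ C : ℝ, ∀ φ : StepFunction k,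
      eLpNorm (φ.integral L) 2 Q ≤ ENNReal.ofReal C * eLpNorm φ.eval 2 volume := by
  set D := ∫ ω, ‖L 1 ω - L 0 ω‖ ^ 2 ∂Q with hD
  have hmem : MemLp (fun ω => L 1 ω - L 0 ω) 2 Q := (hsq 1).sub (hsq 0)
  have hD0 : 0 ≤ D := integral_nonneg fun ω => by positivity
  have hcov : ∀ c, incrCov Q L c c ≤ (k * √D) ^ 2 * ‖c‖ ^ 2 := by
    intro c
    rw [mul_pow, Real.sq_sqrt hD0, hD, mul_right_comm, ← integral_const_mul]
    refine integral_mono (integrable_incr_mul_incr hsq _ _ _ _ _ _)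
      ((hmem.integrable_norm_pow (by norm_num)).const_mul _) fun ω => ?_
    have h1 := abs_dotProduct_le c (L 1 ω - L 0 ω)
    have h2 : incr L c 0 1 ω * incr L c 0 1 ω = |c ⬝ᵥ (L 1 ω - L 0 ω)| ^ 2 := by
      rw [sq_abs, sq]; rfl
    simp only [h2]
    calc |c ⬝ᵥ (L 1 ω - L 0 ω)| ^ 2 ≤ (k * (‖c‖ * ‖L 1 ω - L 0 ω‖)) ^ 2 := by gcongr
      _ = _ := by ring
  refine ⟨k * √D, fun φ => eLpNorm_two_le_of_integral_sq_le (φ.memLp_integral hsq)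
    (φ.memLp_eval 2) (by positivity) ?_⟩
  simp only [Real.norm_eq_abs, sq_abs]
  rw [integral_sq_integral hL hsq hmean, ← integral_const_mul]
  refine integral_mono_of_nonneg (ae_of_all _ fun s => integral_nonneg fun ω => mul_self_nonneg _)
    (((φ.memLp_eval 2).integrable_norm_pow (by norm_num)).const_mul _)
    (ae_of_all _ fun s => hcov _)

end StepFunction

/-! ### Approximation in L² by averages over grid cells -/

section GridAverage

variable {k : ℕ}

/-- The step function of the averages of `f` over the first `N` cells of the grid `u`. -/
noncomputable def gridAverage (f : ℝ → Fin k → ℝ) {u : ℕ → ℝ} (hu : Monotone u) (N : ℕ) :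
    StepFunction k where
  n := N
  a i := u i
  b i := u (i + 1)
  a_le_b _ := hu (Nat.le_succ _)
  c i := ⨍ s in Set.Ioc (u i) (u (i + 1)), f s

theorem gridAverage_eval (f : ℝ → Fin k → ℝ) {u : ℕ → ℝ} (hu : Monotone u) (N : ℕ) (s : ℝ) :
    (gridAverage f hu N).eval s = ∑ i ∈ Finset.range N, (Set.Ioc (u i) (u (i + 1))).indicator
      (fun _ => ⨍ r in Set.Ioc (u i) (u (i + 1)), f r) s :=
  Fin.sum_univ_eq_sum_range (fun i => (Set.Ioc (u i) (u (i + 1))).indicator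
      (fun _ => ⨍ r in Set.Ioc (u i) (u (i + 1)), f r) s) N

theorem pairwise_disjoint_Ioc_of_monotone {u : ℕ → ℝ} (hu : Monotone u) {i j : ℕ} {s : ℝ}
    (hi : s ∈ Set.Ioc (u i) (u (i + 1))) (hj : s ∈ Set.Ioc (u j) (u (j + 1))) : i = j := by
  by_contra hij
  rcases Nat.lt_or_gt_of_ne hij with h | h
  · exact absurd (hj.1.trans_le (hi.2.trans (hu h))) (lt_irrefl _)
  · exact absurd (hi.1.trans_le (hj.2.trans (hu h))) (lt_irrefl _)

/-- The cells are disjoint, so at most one summand is nonzero, and Ψ(0) = 0 settles the points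
outside all cells. -/
theorem comp_sum_indicator_Ioc {E F : Type*} [AddCommMonoid E] [AddCommMonoid F] {Ψ : E → F}
    (h0 : Ψ 0 = 0) {u : ℕ → ℝ} (hu : Monotone u) (N : ℕ) (c : ℕ → E) (s : ℝ) :
    Ψ (∑ i ∈ Finset.range N, (Set.Ioc (u i) (u (i + 1))).indicator (fun _ => c i) s) =
      ∑ i ∈ Finset.range N, (Set.Ioc (u i) (u (i + 1))).indicator (fun _ => Ψ (c i)) s := by
  by_cases h : ∃ i ∈ Finset.range N, s ∈ Set.Ioc (u i) (u (i + 1))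
  · obtain ⟨i, hiN, hi⟩ := h
    rw [Finset.sum_eq_single_of_mem i hiN, Finset.sum_eq_single_of_mem i hiN]
    · simp [Set.indicator_of_mem hi]
    · intro j _ hij
      exact Set.indicator_of_notMem (fun hj => hij (pairwise_disjoint_Ioc_of_monotone hu hj hi)) _
    · intro j _ hij
      exact Set.indicator_of_notMem (fun hj => hij (pairwise_disjoint_Ioc_of_monotone hu hj hi)) _
  · push Not at h
    rw [Finset.sum_eq_zero fun i hi => Set.indicator_of_notMem (h i hi) _, h0,
      Finset.sum_eq_zero fun i hi => Set.indicator_of_notMem (h i hi) _]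

theorem gridAverage_eval_of_mem (f : ℝ → Fin k → ℝ) {u : ℕ → ℝ} (hu : Monotone u) {N i : ℕ}
    (hi : i < N) {s : ℝ} (hs : s ∈ Set.Ioc (u i) (u (i + 1))) :
    (gridAverage f hu N).eval s = ⨍ r in Set.Ioc (u i) (u (i + 1)), f r := by
  rw [gridAverage_eval, Finset.sum_eq_single_of_mem i (Finset.mem_range.2 hi),
    Set.indicator_of_mem hs]
  intro j _ hij
  exact Set.indicator_of_notMem (fun hj => hij (pairwise_disjoint_Ioc_of_monotone hu hj hs)) _

theorem exists_mem_Ioc_of_monotone (u : ℕ → ℝ) (N : ℕ) {s : ℝ}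
    (hs : s ∈ Set.Ioc (u 0) (u N)) : ∃ i < N, s ∈ Set.Ioc (u i) (u (i + 1)) := by
  induction N with
  | zero => simp at hs
  | succ N ih =>
    by_cases h : s ≤ u N
    · obtain ⟨i, hi, his⟩ := ih ⟨hs.1, h⟩
      exact ⟨i, hi.trans N.lt_succ_self, his⟩
    · exact ⟨N, N.lt_succ_self, not_le.1 h, hs.2⟩

theorem gridAverage_eval_of_notMem (f : ℝ → Fin k → ℝ) {u : ℕ → ℝ} (hu : Monotone u) {N : ℕ}
    {s : ℝ} (hs : s ∉ Set.Ioc (u 0) (u N)) : (gridAverage f hu N).eval s = 0 := by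
  rw [gridAverage_eval]
  refine Finset.sum_eq_zero fun i hi => Set.indicator_of_notMem (fun h => hs ?_) _
  exact ⟨(hu (Nat.zero_le i)).trans_lt h.1, h.2.trans (hu (Finset.mem_range.1 hi))⟩

theorem lintegral_comp_gridAverage (f : ℝ → Fin k → ℝ) {u : ℕ → ℝ} (hu : Monotone u) (N : ℕ)
    {Ψ : (Fin k → ℝ) → ℝ≥0∞} (h0 : Ψ 0 = 0) :
    ∫⁻ s, Ψ ((gridAverage f hu N).eval s) = ∑ i ∈ Finset.range N,
      ENNReal.ofReal (u (i + 1) - u i) * Ψ (⨍ r in Set.Ioc (u i) (u (i + 1)), f r) := by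
  simp only [gridAverage_eval, comp_sum_indicator_Ioc h0 hu]
  rw [lintegral_finsetSum _ fun i _ => measurable_const.indicator measurableSet_Ioc]
  refine Finset.sum_congr rfl fun i _ => ?_
  rw [lintegral_indicator measurableSet_Ioc, setLIntegral_const, Real.volume_Ioc, mul_comm]

theorem sum_setLIntegral_Ioc_le {u : ℕ → ℝ} (hu : Monotone u) (N : ℕ) (F : ℝ → ℝ≥0∞) :
    ∑ i ∈ Finset.range N, ∫⁻ s in Set.Ioc (u i) (u (i + 1)), F s ≤ ∫⁻ s, F s := by
  have hd : Set.PairwiseDisjoint (↑(Finset.range N)) fun i => Set.Ioc (u i) (u (i + 1)) :=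
    fun i _ j _ hij => Set.disjoint_left.2 fun s hi hj =>
      hij (pairwise_disjoint_Ioc_of_monotone hu hi hj)
  rw [← lintegral_biUnion_finset hd fun _ _ => measurableSet_Ioc]
  exact setLIntegral_le_lintegral _ _

/-- Jensen on each cell sums to Jensen on the line. It is used for the squared norm, to get an L²
contraction, and for the extended cumulant. -/
theorem lintegral_comp_gridAverage_le (f : ℝ → Fin k → ℝ) {u : ℕ → ℝ} (hu : Monotone u) (N : ℕ)
    {Ψ : (Fin k → ℝ) → ℝ≥0∞} (h0 : Ψ 0 = 0)
    (hΨ : ∀ a b, a < b → ENNReal.ofReal (b - a) * Ψ (⨍ r in Set.Ioc a b, f r) ≤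
      ∫⁻ s in Set.Ioc a b, Ψ (f s)) :
    ∫⁻ s, Ψ ((gridAverage f hu N).eval s) ≤ ∫⁻ s, Ψ (f s) := by
  rw [lintegral_comp_gridAverage f hu N h0]
  refine (Finset.sum_le_sum fun i _ => ?_).trans (sum_setLIntegral_Ioc_le hu N _)
  rcases (hu (Nat.le_succ i)).eq_or_lt with h | h
  · simp [h]
  · exact hΨ _ _ h

theorem integrableOn_Ioc_of_memLp {f : ℝ → Fin k → ℝ} (hf : MemLp f 2 volume) (a b : ℝ) :
    IntegrableOn f (Set.Ioc a b) :=
  (hf.restrict _).integrable (by norm_num)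

/-- The Cauchy–Schwarz inequality on (a, b]. -/
theorem enorm_setAverage_sq_le {f : ℝ → Fin k → ℝ} (hf : MemLp f 2 volume) {a b : ℝ}
    (hab : a < b) : ENNReal.ofReal (b - a) * ‖⨍ r in Set.Ioc a b, f r‖ₑ ^ 2 ≤
      ∫⁻ s in Set.Ioc a b, ‖f s‖ₑ ^ 2 := by
  set h := ENNReal.ofReal (b - a) with hh
  have h0 : h ≠ 0 := by simpa [hh] using hab
  have htop : h ≠ ⊤ := ENNReal.ofReal_ne_top
  have e1 : ‖∫ r in Set.Ioc a b, f r‖ₑ ≤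
      eLpNorm f 2 (volume.restrict (Set.Ioc a b)) * h ^ (1 / 2 : ℝ) := by
    refine (enorm_integral_le_lintegral_enorm _).trans ?_
    rw [← eLpNorm_one_eq_lintegral_enorm]
    refine (eLpNorm_le_eLpNorm_mul_rpow_measure_univ (q := 2) (by norm_num)
      (hf.restrict _).aestronglyMeasurable).trans (le_of_eq ?_)
    simp only [Measure.restrict_apply_univ, Real.volume_Ioc, ← hh]
    norm_num
  have e2 : eLpNorm f 2 (volume.restrict (Set.Ioc a b)) ^ 2 =
      ∫⁻ s in Set.Ioc a b, ‖f s‖ₑ ^ 2 := by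
    have := eLpNorm_nnreal_pow_eq_lintegral (f := f) (μ := volume.restrict (Set.Ioc a b))
      (p := 2) (by norm_num)
    simpa using this
  have e3 : ‖⨍ r in Set.Ioc a b, f r‖ₑ = h⁻¹ * ‖∫ r in Set.Ioc a b, f r‖ₑ := by
    rw [setAverage_eq, enorm_smul]
    congr 1
    rw [Measure.real, Real.volume_Ioc, ← hh, Real.enorm_eq_ofReal (by positivity),
      ENNReal.ofReal_inv_of_pos (ENNReal.toReal_pos h0 htop), ENNReal.ofReal_toReal htop]
  calc h * ‖⨍ r in Set.Ioc a b, f r‖ₑ ^ 2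
      ≤ h * (h⁻¹ * (eLpNorm f 2 (volume.restrict (Set.Ioc a b)) * h ^ (1 / 2 : ℝ))) ^ 2 := by
        rw [e3]; gcongr
    _ = (h * h⁻¹) * (h⁻¹ * (h ^ (1 / 2 : ℝ)) ^ 2) * (∫⁻ s in Set.Ioc a b, ‖f s‖ₑ ^ 2) := by
        rw [← e2]; ring
    _ = _ := by
        rw [← ENNReal.rpow_natCast (h ^ (1 / 2 : ℝ)), ← ENNReal.rpow_mul]
        norm_num
        rw [ENNReal.mul_inv_cancel h0 htop, ENNReal.inv_mul_cancel h0 htop]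
        simp

theorem eLpNorm_gridAverage_le {f : ℝ → Fin k → ℝ} (hf : MemLp f 2 volume) {u : ℕ → ℝ}
    (hu : Monotone u) (N : ℕ) :
    eLpNorm (gridAverage f hu N).eval 2 volume ≤ eLpNorm f 2 volume := by
  have e : ∀ g : ℝ → Fin k → ℝ, eLpNorm g 2 volume ^ 2 = ∫⁻ s, ‖g s‖ₑ ^ 2 := by
    intro g
    have := eLpNorm_nnreal_pow_eq_lintegral (f := g) (μ := volume) (p := 2) (by norm_num)
    simpa using this
  rw [← ENNReal.pow_le_pow_left_iff two_ne_zero, e, e]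
  exact lintegral_comp_gridAverage_le f hu N (Ψ := fun x => ‖x‖ₑ ^ 2) (by simp)
    fun a b hab => enorm_setAverage_sq_le hf hab

theorem gridAverage_sub {f g : ℝ → Fin k → ℝ} (hf : MemLp f 2 volume) (hg : MemLp g 2 volume)
    {u : ℕ → ℝ} (hu : Monotone u) (N : ℕ) (s : ℝ) :
    (gridAverage (f - g) hu N).eval s =
      (gridAverage f hu N).eval s - (gridAverage g hu N).eval s := by
  simp only [gridAverage_eval, ← Finset.sum_sub_distrib]
  refine Finset.sum_congr rfl fun i _ => ?_
  have : ⨍ r in Set.Ioc (u i) (u (i + 1)), (f - g) r =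
      (⨍ r in Set.Ioc (u i) (u (i + 1)), f r) - ⨍ r in Set.Ioc (u i) (u (i + 1)), g r := by
    simp only [setAverage_eq, Pi.sub_apply]
    rw [integral_sub (integrableOn_Ioc_of_memLp hf _ _) (integrableOn_Ioc_of_memLp hg _ _),
      smul_sub]
  rw [this]
  by_cases h : s ∈ Set.Ioc (u i) (u (i + 1)) <;> simp [h]

/-- The grid with mesh `1 / (n + 1)` starting at `-(n + 1)`. -/
noncomputable def uniformGrid (n i : ℕ) : ℝ := -(n + 1) + i / (n + 1)

theorem monotone_uniformGrid (n : ℕ) : Monotone (uniformGrid n) := by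
  intro i j hij
  unfold uniformGrid
  gcongr

theorem uniformGrid_zero (n : ℕ) : uniformGrid n 0 = -(n + 1) := by simp [uniformGrid]

theorem uniformGrid_last (n : ℕ) : uniformGrid n (2 * (n + 1) ^ 2) = n + 1 := by
  have : (n + 1 : ℝ) ≠ 0 := by positivity
  unfold uniformGrid
  push_cast
  field_simp
  ring

theorem uniformGrid_succ (n i : ℕ) : uniformGrid n (i + 1) = uniformGrid n i + 1 / (n + 1) := by
  unfold uniformGrid
  push_cast
  ring

/-- The step function of the averages of `f` over the cells of length `1 / (n + 1)` between
`-(n + 1)` and `n + 1`. -/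
noncomputable def averageStep (f : ℝ → Fin k → ℝ) (n : ℕ) : StepFunction k :=
  gridAverage f (monotone_uniformGrid n) (2 * (n + 1) ^ 2)

theorem tendsto_averageStep_of_hasCompactSupport {g : ℝ → Fin k → ℝ} (hg : Continuous g)
    (hgc : HasCompactSupport g) :
    Tendsto (fun n => eLpNorm (fun s => (averageStep g n).eval s - g s) 2 volume) atTop (𝓝 0) := by
  obtain ⟨R, hR0, hR⟩ : ∃ R : ℝ, 0 < R ∧ ∀ s, R < |s| → g s = 0 := by
    obtain ⟨R, hR⟩ := hgc.isCompact.isBounded.subset_closedBall 0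
    refine ⟨max R 1, lt_max_of_lt_right one_pos, fun s hs => ?_⟩
    by_contra h
    have := hR (subset_tsupport g h)
    rw [mem_closedBall_zero_iff, Real.norm_eq_abs] at this
    exact absurd (this.trans (le_max_left R 1)) hs.not_ge
  have huc := hgc.uniformContinuous_of_continuous hg
  set K := Set.Icc (-(R + 1)) (R + 1)
  have hK : ∀ s, s ∉ K → R + 1 < |s| := by
    intro s hs
    by_contra h
    exact hs (abs_le.1 (not_lt.1 h))
  have key : ∀ ε : ℝ, 0 < ε → ∀ᶠ n : ℕ in atTop, ∀ s,
      ‖(averageStep g n).eval s - g s‖ ≤ K.indicator (fun _ => ε) s := by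
    intro ε hε
    obtain ⟨δ, hδ, hgδ⟩ := Metric.uniformContinuous_iff.1 huc ε hε
    obtain ⟨n₀, hn₀⟩ := exists_nat_ge (max R (1 / δ))
    filter_upwards [eventually_ge_atTop n₀] with n hn s
    have hn' : (n₀ : ℝ) ≤ n := Nat.cast_le.2 hn
    have hnR : R ≤ n := (le_max_left _ _).trans (hn₀.trans hn')
    have hnδ : 1 / (n + 1 : ℝ) < δ := by
      rw [one_div_lt (by positivity) hδ]
      have := (le_max_right R (1 / δ)).trans (hn₀.trans hn')
      linarith
    have hn1 : 1 / (n + 1 : ℝ) ≤ 1 := by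
      rw [div_le_one (by positivity)]
      linarith [n.cast_nonneg (α := ℝ)]
    by_cases hs : s ∈ Set.Ioc (uniformGrid n 0) (uniformGrid n (2 * (n + 1) ^ 2))
    · obtain ⟨i, hi, his⟩ := exists_mem_Ioc_of_monotone _ _ hs
      rw [averageStep, gridAverage_eval_of_mem g _ hi his]
      have hlen := uniformGrid_succ n i
      have hpos : (0 : ℝ) < 1 / (n + 1) := by positivity
      have hv0 : volume (Set.Ioc (uniformGrid n i) (uniformGrid n (i + 1))) ≠ 0 := by
        rw [Real.volume_Ioc, hlen]
        simpa using hpos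
      have hclose : ∀ r ∈ Set.Ioc (uniformGrid n i) (uniformGrid n (i + 1)),
          |r - s| ≤ 1 / (n + 1) := by
        intro r hr
        rw [abs_le]
        constructor <;> linarith [hr.1, hr.2, his.1, his.2]
      -- The average over a cell stays in every closed convex set containing the values there: a
      -- small ball around g(s) for s in K, and {0} off K, where a cell of length at most 1 misses
      -- the support.
      have hmem : ∀ C : Set (Fin k → ℝ), Convex ℝ C → IsClosed C →
          (∀ r ∈ Set.Ioc (uniformGrid n i) (uniformGrid n (i + 1)), g r ∈ C) →
          (⨍ r in Set.Ioc (uniformGrid n i) (uniformGrid n (i + 1)), g r) ∈ C := by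
        intro C h1 h2 h3
        exact h1.set_average_mem h2 hv0 (by simp)
          ((ae_restrict_iff' measurableSet_Ioc).2 (ae_of_all _ h3))
          (hg.integrableOn_Ioc)
      by_cases hsK : s ∈ K
      · rw [Set.indicator_of_mem hsK, ← mem_closedBall_iff_norm]
        refine hmem _ (convex_closedBall _ _) Metric.isClosed_closedBall fun r hr => ?_
        refine Metric.mem_closedBall.2 (hgδ ?_).le
        rw [Real.dist_eq]
        exact (hclose r hr).trans_lt hnδ
      · have hsR := hK s hsK
        rw [Set.indicator_of_notMem hsK, hR s (by linarith)]
        have := hmem {0} (convex_singleton 0) isClosed_singleton fun r hr => ?_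
        · rw [this]; simp
        · refine hR r ?_
          have := abs_sub_abs_le_abs_sub s r
          rw [abs_sub_comm] at this
          linarith [hclose r hr]
    · rw [averageStep, gridAverage_eval_of_notMem g _ hs, hR s, sub_zero, norm_zero]
      · exact Set.indicator_nonneg (fun _ _ => hε.le) s
      · rw [uniformGrid_zero, uniformGrid_last] at hs
        by_contra h
        obtain ⟨h1, h2⟩ := abs_le.1 (not_lt.1 h)
        exact hs ⟨by linarith, by linarith⟩
  have hKv : volume K ≠ ⊤ := by simp [K]
  have hcp : volume K ^ (1 / (2 : ℝ≥0∞).toReal) ≠ ⊤ :=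
    ENNReal.rpow_ne_top_of_nonneg (by positivity) hKv
  rw [ENNReal.tendsto_nhds_zero]
  intro ε hε
  obtain ⟨r, hr, hrε⟩ : ∃ r : ℝ≥0, 0 < r ∧
      (r : ℝ≥0∞) * volume K ^ (1 / (2 : ℝ≥0∞).toReal) ≤ ε := by
    rcases eq_or_ne ε ⊤ with rfl | hεt
    · exact ⟨1, one_pos, le_top⟩
    obtain ⟨r, hr0, hr⟩ := ENNReal.exists_nnreal_pos_mul_lt hcp hε.ne'
    exact ⟨r, hr0, hr.le⟩
  filter_upwards [key r (NNReal.coe_pos.2 hr)] with n hn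
  calc eLpNorm (fun s => (averageStep g n).eval s - g s) 2 volume
      ≤ eLpNorm (K.indicator fun _ => (r : ℝ)) 2 volume := eLpNorm_mono_real hn
    _ = r * volume K ^ (1 / (2 : ℝ≥0∞).toReal) := by
        rw [eLpNorm_indicator_const measurableSet_Icc (by norm_num) (by norm_num),
          Real.enorm_eq_ofReal (NNReal.coe_nonneg r), ENNReal.ofReal_coe_nnreal]
    _ ≤ ε := hrε

/-- Averaging is a linear L² contraction, so convergence passes from the dense class of continuous
compactly supported functions to all of L². -/
theorem tendsto_averageStep {f : ℝ → Fin k → ℝ} (hf : MemLp f 2 volume) :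
    Tendsto (fun n => eLpNorm (fun s => (averageStep f n).eval s - f s) 2 volume) atTop (𝓝 0) := by
  rw [ENNReal.tendsto_nhds_zero]
  intro ε hε
  have hε3 : ε / 3 ≠ 0 := (ENNReal.div_pos hε.ne' (by norm_num)).ne'
  obtain ⟨g, hgc, hfg, hg, hgm⟩ := hf.exists_hasCompactSupport_eLpNorm_sub_le (by norm_num) hε3
  filter_upwards [(ENNReal.tendsto_nhds_zero.1 (tendsto_averageStep_of_hasCompactSupport hg hgc))
    (ε / 3) (pos_iff_ne_zero.2 hε3)] with n hn
  have e : (fun s => (averageStep f n).eval s - f s) = (averageStep (f - g) n).eval +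
      (fun s => (averageStep g n).eval s - g s) + (g - f) := by
    ext1 s
    simp only [Pi.add_apply, averageStep, gridAverage_sub hf hgm, Pi.sub_apply]
    abel
  have m1 := ((averageStep (f - g) n).memLp_eval 2).aestronglyMeasurable
  have m2 := ((averageStep g n).memLp_eval 2).aestronglyMeasurable.sub hgm.aestronglyMeasurable
  rw [e]
  calc _ ≤ eLpNorm (averageStep (f - g) n).eval 2 volume +
        eLpNorm (fun s => (averageStep g n).eval s - g s) 2 volume + eLpNorm (g - f) 2 volume := by
        refine (eLpNorm_add_le (m1.add m2) (hgm.sub hf).aestronglyMeasurable (by norm_num)).trans ?_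
        gcongr
        exact eLpNorm_add_le m1 m2 (by norm_num)
    _ ≤ ε / 3 + ε / 3 + ε / 3 := by
        gcongr
        · exact (eLpNorm_gridAverage_le (hf.sub hgm) _ _).trans hfg
        · rw [eLpNorm_sub_comm]; exact hfg
    _ = ε := ENNReal.add_thirds ε

end GridAverage

/-! ### The stochastic integral: linearity, uniqueness, existence, measurability -/

section LevyIntegral

variable {Ω : Type*} {k : ℕ} [mΩ : MeasurableSpace Ω] {Q : Measure Ω} [IsProbabilityMeasure Q]
  {L : ℝ → Ω → Fin k → ℝ}

theorem isLevyIntegral_step (hsq : ∀ t, MemLp (L t) 2 Q) (φ : StepFunction k) :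
    IsLevyIntegral Q L φ.eval (φ.integral L) :=
  ⟨φ.memLp_eval 2, φ.memLp_integral hsq, fun _ => φ, by simp, by simp⟩

namespace IsLevyIntegral

variable {f g : ℝ → Fin k → ℝ} {I J : Ω → ℝ}

theorem congr (h : IsLevyIntegral Q L f I) (hfg : f =ᵐ[volume] g) (hIJ : I =ᵐ[Q] J) :
    IsLevyIntegral Q L g J := by
  obtain ⟨hf, hI, φ, h1, h2⟩ := h
  refine ⟨hf.ae_eq hfg, hI.ae_eq hIJ, φ, h1.congr fun n => eLpNorm_congr_ae ?_,
    h2.congr fun n => eLpNorm_congr_ae ?_⟩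
  · filter_upwards [hfg] with s hs using by rw [hs]
  · filter_upwards [hIJ] with s hs using by rw [hs]

theorem add (hsq : ∀ t, MemLp (L t) 2 Q) (hI : IsLevyIntegral Q L f I)
    (hJ : IsLevyIntegral Q L g J) :
    IsLevyIntegral Q L (fun s => f s + g s) (fun ω => I ω + J ω) := by
  obtain ⟨hf, hI, φ, h1, h2⟩ := hI
  obtain ⟨hg, hJ, χ, h3, h4⟩ := hJ
  refine ⟨hf.add hg, hI.add hJ, fun n => (φ n).add (χ n), ?_, ?_⟩
  · refine tendsto_of_tendsto_of_tendsto_of_le_of_le tendsto_const_nhds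
      (by simpa using h1.add h3) (fun _ => zero_le) fun n => ?_
    refine le_trans (le_of_eq ?_) (eLpNorm_add_le
      (((φ n).memLp_eval 2).sub hf).aestronglyMeasurable
      (((χ n).memLp_eval 2).sub hg).aestronglyMeasurable (by norm_num))
    congr 1
    ext1 s
    simp only [StepFunction.eval_add, Pi.add_apply]
    abel
  · refine tendsto_of_tendsto_of_tendsto_of_le_of_le tendsto_const_nhds
      (by simpa using h2.add h4) (fun _ => zero_le) fun n => ?_
    refine le_trans (le_of_eq ?_) (eLpNorm_add_le
      (((φ n).memLp_integral hsq).sub hI).aestronglyMeasurable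
      (((χ n).memLp_integral hsq).sub hJ).aestronglyMeasurable (by norm_num))
    congr 1
    ext1 s
    simp only [StepFunction.integral_add, Pi.add_apply]
    abel

theorem const_mul (r : ℝ) (hI : IsLevyIntegral Q L f I) :
    IsLevyIntegral Q L (fun s => r • f s) (fun ω => r * I ω) := by
  obtain ⟨hf, hI, φ, h1, h2⟩ := hI
  refine ⟨hf.const_smul r, hI.const_mul r, fun n => (φ n).smul r, ?_, ?_⟩
  · have := ENNReal.Tendsto.const_mul (a := ‖r‖ₑ) h1 (Or.inr enorm_ne_top)
    rw [mul_zero] at this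
    refine this.congr fun n => ?_
    rw [← eLpNorm_const_smul]
    congr 1
    ext1 s
    simp only [StepFunction.eval_smul, Pi.smul_apply, smul_sub]
  · have := ENNReal.Tendsto.const_mul (a := ‖r‖ₑ) h2 (Or.inr enorm_ne_top)
    rw [mul_zero] at this
    refine this.congr fun n => ?_
    rw [← eLpNorm_const_smul]
    congr 1
    ext1 s
    simp only [StepFunction.integral_smul, Pi.smul_apply, smul_eq_mul, mul_sub]

theorem sub (hsq : ∀ t, MemLp (L t) 2 Q) (hI : IsLevyIntegral Q L f I)
    (hJ : IsLevyIntegral Q L g J) :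
    IsLevyIntegral Q L (fun s => f s - g s) (fun ω => I ω - J ω) := by
  simpa [sub_eq_add_neg] using hI.add hsq (hJ.const_mul (-1))

theorem eLpNorm_le {C : ℝ} (hC : ∀ φ : StepFunction k,
      eLpNorm (φ.integral L) 2 Q ≤ ENNReal.ofReal C * eLpNorm φ.eval 2 volume)
    (hsq : ∀ t, MemLp (L t) 2 Q) (hI : IsLevyIntegral Q L f I) :
    eLpNorm I 2 Q ≤ ENNReal.ofReal C * eLpNorm f 2 volume := by
  obtain ⟨hf, hI, φ, h1, h2⟩ := hI
  have hlim := h2.add (ENNReal.Tendsto.const_mul (a := ENNReal.ofReal C)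
    (h1.add_const (eLpNorm f 2 volume)) (Or.inr ENNReal.ofReal_ne_top))
  simp only [zero_add] at hlim
  refine ge_of_tendsto' hlim fun n => ?_
  have e1 : eLpNorm I 2 Q ≤ eLpNorm (fun ω => (φ n).integral L ω - I ω) 2 Q +
      eLpNorm ((φ n).integral L) 2 Q := by
    have : I = (φ n).integral L - fun ω => (φ n).integral L ω - I ω := by ext1 ω; simp
    conv_lhs => rw [this]
    rw [add_comm]
    exact eLpNorm_sub_le ((φ n).memLp_integral hsq).aestronglyMeasurable
      (((φ n).memLp_integral hsq).sub hI).aestronglyMeasurable (by norm_num)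
  have e2 : eLpNorm (φ n).eval 2 volume ≤ eLpNorm (fun s => (φ n).eval s - f s) 2 volume +
      eLpNorm f 2 volume := by
    have : (φ n).eval = (fun s => (φ n).eval s - f s) + f := by ext1 s; simp
    conv_lhs => rw [this]
    exact eLpNorm_add_le (((φ n).memLp_eval 2).sub hf).aestronglyMeasurable
      hf.aestronglyMeasurable (by norm_num)
  refine e1.trans ?_
  gcongr
  exact (hC _).trans (by gcongr)

theorem ae_eq (hL : IsTwoSidedLevy Q L) (hsq : ∀ t, MemLp (L t) 2 Q)
    (hmean : ∀ t, ∫ ω, L t ω ∂Q = 0) (hI : IsLevyIntegral Q L f I) (hJ : IsLevyIntegral Q L g J)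
    (hfg : f =ᵐ[volume] g) : I =ᵐ[Q] J := by
  obtain ⟨C, hC⟩ := StepFunction.exists_eLpNorm_integral_le hL hsq hmean
  have h := (hI.sub hsq hJ).eLpNorm_le hC hsq
  have h0 : eLpNorm (fun s => f s - g s) 2 volume = 0 := by
    rw [eLpNorm_congr_ae (g := fun _ => 0), eLpNorm_zero']
    filter_upwards [hfg] with s hs using by simp [hs]
  rw [h0, mul_zero, nonpos_iff_eq_zero,
    eLpNorm_eq_zero_iff (f := fun ω => I ω - J ω) (hI.2.1.sub hJ.2.1).aestronglyMeasurable
      (by norm_num)] at h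
  filter_upwards [h] with ω hω
  exact sub_eq_zero.1 hω

theorem tendsto (hL : IsTwoSidedLevy Q L) (hsq : ∀ t, MemLp (L t) 2 Q)
    (hmean : ∀ t, ∫ ω, L t ω ∂Q = 0) {f : ℕ → ℝ → Fin k → ℝ} {I : ℕ → Ω → ℝ}
    (hI : ∀ n, IsLevyIntegral Q L (f n) (I n)) (hJ : IsLevyIntegral Q L g J)
    (h : Tendsto (fun n => eLpNorm (fun s => f n s - g s) 2 volume) atTop (𝓝 0)) :
    Tendsto (fun n => eLpNorm (fun ω => I n ω - J ω) 2 Q) atTop (𝓝 0) := by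
  obtain ⟨C, hC⟩ := StepFunction.exists_eLpNorm_integral_le hL hsq hmean
  have := ENNReal.Tendsto.const_mul (a := ENNReal.ofReal C) h (Or.inr ENNReal.ofReal_ne_top)
  rw [mul_zero] at this
  exact tendsto_of_tendsto_of_tendsto_of_le_of_le tendsto_const_nhds this (fun _ => zero_le)
    fun n => ((hI n).sub hsq hJ).eLpNorm_le hC hsq

theorem integral_eq_zero (hsq : ∀ t, MemLp (L t) 2 Q)
    (hmean : ∀ t, ∫ ω, L t ω ∂Q = 0) (hI : IsLevyIntegral Q L f I) : ∫ ω, I ω ∂Q = 0 := by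
  obtain ⟨hf, hI, φ, h1, h2⟩ := hI
  have h3 : Tendsto (fun n => ∫ ω, (φ n).integral L ω ∂Q) atTop (𝓝 (∫ ω, I ω ∂Q)) := by
    refine tendsto_integral_of_L1' I hI.aestronglyMeasurable
      (Eventually.of_forall fun n => ((φ n).memLp_integral hsq).integrable (by norm_num)) ?_
    refine tendsto_of_tendsto_of_tendsto_of_le_of_le tendsto_const_nhds h2 (fun _ => zero_le)
      fun n => ?_
    exact eLpNorm_le_eLpNorm_of_exponent_le (by norm_num)
      (((φ n).memLp_integral hsq).sub hI).aestronglyMeasurable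
  simp only [StepFunction.integral_integral hsq hmean] at h3
  exact tendsto_nhds_unique h3 tendsto_const_nhds

/-- The bound for step functions makes the elementary integrals of the grid averages Cauchy in
L²(Q), which is complete. -/
theorem exists_of_memLp (hL : IsTwoSidedLevy Q L) (hsq : ∀ t, MemLp (L t) 2 Q)
    (hmean : ∀ t, ∫ ω, L t ω ∂Q = 0) (hf : MemLp f 2 volume) : ∃ I, IsLevyIntegral Q L f I := by
  obtain ⟨C, hC⟩ := StepFunction.exists_eLpNorm_integral_le hL hsq hmean
  set φ := averageStep f
  have hφ : Tendsto (fun n => eLpNorm (fun s => (φ n).eval s - f s) 2 volume) atTop (𝓝 0) :=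
    tendsto_averageStep hf
  have hmem : ∀ n, MemLp ((φ n).integral L) 2 Q := fun n => (φ n).memLp_integral hsq
  have hbound : ∀ m n, eLpNorm ((φ m).integral L - (φ n).integral L) 2 Q ≤ ENNReal.ofReal C *
      (eLpNorm (fun s => (φ m).eval s - f s) 2 volume +
        eLpNorm (fun s => (φ n).eval s - f s) 2 volume) := by
    intro m n
    refine (((isLevyIntegral_step hsq (φ m)).sub hsq
      (isLevyIntegral_step hsq (φ n))).eLpNorm_le hC hsq).trans ?_
    gcongr
    have : (fun s => (φ m).eval s - (φ n).eval s) =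
        (fun s => (φ m).eval s - f s) - fun s => (φ n).eval s - f s := by ext1 s; simp
    rw [this]
    exact eLpNorm_sub_le (((φ m).memLp_eval 2).sub hf).aestronglyMeasurable
      (((φ n).memLp_eval 2).sub hf).aestronglyMeasurable (by norm_num)
  have hcau : CauchySeq fun n => (hmem n).toLp := by
    refine EMetric.cauchySeq_iff'.2 fun ε hε => ?_
    have hlim := ENNReal.Tendsto.const_mul (a := ENNReal.ofReal C) hφ
      (Or.inr ENNReal.ofReal_ne_top)
    rw [mul_zero] at hlim
    obtain ⟨N, hN⟩ := eventually_atTop.1 (hlim.eventually_lt_const (ENNReal.half_pos hε.ne'))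
    refine ⟨N, fun n hn => ?_⟩
    rw [Lp.edist_toLp_toLp]
    refine (hbound n N).trans_lt ?_
    rw [mul_add]
    calc _ < ε / 2 + ε / 2 := ENNReal.add_lt_add (hN n hn) (hN N le_rfl)
      _ = ε := ENNReal.add_halves ε
  obtain ⟨I, hI⟩ := cauchySeq_tendsto_of_complete hcau
  refine ⟨I, hf, Lp.memLp I, φ, hφ, ?_⟩
  rw [Lp.tendsto_Lp_iff_tendsto_eLpNorm' (fun n => (hmem n).toLp) I] at hI
  refine hI.congr fun n => eLpNorm_congr_ae ?_
  filter_upwards [(hmem n).coeFn_toLp] with ω hω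
  simp [hω]

theorem levyIntegral (hL : IsTwoSidedLevy Q L) (hsq : ∀ t, MemLp (L t) 2 Q)
    (hmean : ∀ t, ∫ ω, L t ω ∂Q = 0) (hf : MemLp f 2 volume) :
    IsLevyIntegral Q L f (levyIntegral Q L f) := by
  have h := exists_of_memLp hL hsq hmean hf
  rw [_root_.levyIntegral, dif_pos h]
  exact h.choose_spec

theorem tendsto_indicator {φ : ℕ → StepFunction k} (A : Set ℝ)
    (h : Tendsto (fun n => eLpNorm (fun s => (φ n).eval s - f s) 2 volume) atTop (𝓝 0)) :
    Tendsto (fun n => eLpNorm (fun s => A.indicator (φ n).eval s - A.indicator f s) 2 volume)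
      atTop (𝓝 0) := by
  refine tendsto_of_tendsto_of_tendsto_of_le_of_le tendsto_const_nhds h (fun _ => zero_le)
    fun n => ?_
  have : (fun s => A.indicator (φ n).eval s - A.indicator f s) =
      A.indicator fun s => (φ n).eval s - f s := by
    ext1 s
    by_cases hs : s ∈ A <;> simp [hs]
  rw [this]
  exact eLpNorm_indicator_le _

/-- The averages of f itself are cut at a, rather than those of its restriction, for which a cell
straddling a could involve times after a. The approximants then use only increments up to a, whence
the measurability below. -/
theorem tendsto_below (hL : IsTwoSidedLevy Q L)
    (hsq : ∀ t, MemLp (L t) 2 Q) (hmean : ∀ t, ∫ ω, L t ω ∂Q = 0) {a : ℝ}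
    (hf : MemLp f 2 volume) (hI : IsLevyIntegral Q L ((Set.Iic a).indicator f) I) :
    Tendsto (fun n => eLpNorm (fun ω => ((averageStep f n).below a).integral L ω - I ω) 2 Q)
      atTop (𝓝 0) := by
  refine IsLevyIntegral.tendsto hL hsq hmean
    (fun n => isLevyIntegral_step hsq ((averageStep f n).below a)) hI ?_
  simp only [StepFunction.eval_below]
  exact tendsto_indicator _ (tendsto_averageStep hf)

theorem tendsto_above (hL : IsTwoSidedLevy Q L)
    (hsq : ∀ t, MemLp (L t) 2 Q) (hmean : ∀ t, ∫ ω, L t ω ∂Q = 0) {a : ℝ}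
    (hf : MemLp f 2 volume) (hI : IsLevyIntegral Q L ((Set.Ioi a).indicator f) I) :
    Tendsto (fun n => eLpNorm (fun ω => ((averageStep f n).above a).integral L ω - I ω) 2 Q)
      atTop (𝓝 0) := by
  refine IsLevyIntegral.tendsto hL hsq hmean
    (fun n => isLevyIntegral_step hsq ((averageStep f n).above a)) hI ?_
  simp only [StepFunction.eval_above]
  exact tendsto_indicator _ (tendsto_averageStep hf)

theorem aestronglyMeasurable_of_indicator_Iic (hL : IsTwoSidedLevy Q L)
    (hsq : ∀ t, MemLp (L t) 2 Q) (hmean : ∀ t, ∫ ω, L t ω ∂Q = 0) {a : ℝ}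
    (hf : MemLp f 2 volume) (hI : IsLevyIntegral Q L ((Set.Iic a).indicator f) I)
    {m : MeasurableSpace Ω} (hm : m ≤ mΩ)
    (hmL : ∀ p q, p ≤ a → q ≤ a → Measurable[m] fun ω => L q ω - L p ω) :
    AEStronglyMeasurable[m] I Q :=
  aestronglyMeasurable_of_tendsto_eLpNorm hm hI.2.1.aestronglyMeasurable
    (fun _ => StepFunction.measurable_integral _ fun _ =>
      hmL _ _ (min_le_right _ _) (min_le_right _ _)) (tendsto_below (mΩ := mΩ) hL hsq hmean hf hI)

theorem aestronglyMeasurable_of_indicator_Ioi (hL : IsTwoSidedLevy Q L)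
    (hsq : ∀ t, MemLp (L t) 2 Q) (hmean : ∀ t, ∫ ω, L t ω ∂Q = 0) {a : ℝ}
    (hf : MemLp f 2 volume) (hI : IsLevyIntegral Q L ((Set.Ioi a).indicator f) I) :
    AEStronglyMeasurable[futureIncrements L a] I Q :=
  aestronglyMeasurable_of_tendsto_eLpNorm
    (futureIncrements_le fun p _ => (hL.measurable p).sub (hL.measurable a))
    hI.2.1.aestronglyMeasurable
    (fun _ => StepFunction.measurable_integral _ fun _ =>
      measurable_futureIncrements L (le_max_right _ _) (le_max_right _ _))
    (tendsto_above hL hsq hmean hf hI)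

end IsLevyIntegral

end LevyIntegral

/-! ### Exponential moments and exchangeability of increments -/

section ExpMoment

theorem ofReal_integral_le_lintegral {α : Type*} [MeasurableSpace α] {μ : Measure α} {F : α → ℝ}
    (hF : Integrable F μ) : ENNReal.ofReal (∫ x, F x ∂μ) ≤ ∫⁻ x, ENNReal.ofReal (F x) ∂μ := by
  rw [integral_eq_lintegral_pos_part_sub_lintegral_neg_part hF]
  exact (ENNReal.ofReal_le_ofReal (sub_le_self _ ENNReal.toReal_nonneg)).trans
    ENNReal.ofReal_toReal_le

variable {Ω : Type*} {k : ℕ} [mΩ : MeasurableSpace Ω] {Q : Measure Ω}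

/-- The `[0, ∞]`-valued exponential moment `E[exp X]`. -/
noncomputable def expMoment (Q : Measure Ω) (X : Ω → ℝ) : ℝ≥0∞ :=
  ∫⁻ ω, ENNReal.ofReal (Real.exp (X ω)) ∂Q

theorem expMoment_congr {X Y : Ω → ℝ} (h : X =ᵐ[Q] Y) : expMoment Q X = expMoment Q Y :=
  lintegral_congr_ae (by filter_upwards [h] with ω hω using by rw [hω])

theorem expMoment_eq_of_identDistrib {X Y : Ω → ℝ} (h : IdentDistrib X Y Q Q) :
    expMoment Q X = expMoment Q Y :=
  (h.comp (u := fun x => ENNReal.ofReal (Real.exp x)) (by fun_prop)).lintegral_eq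

theorem integrable_exp_iff {X : Ω → ℝ} (hX : AEStronglyMeasurable X Q) :
    Integrable (fun ω => Real.exp (X ω)) Q ↔ expMoment Q X ≠ ⊤ := by
  have hm : AEStronglyMeasurable (fun ω => Real.exp (X ω)) Q :=
    Real.continuous_exp.comp_aestronglyMeasurable hX
  rw [Integrable, and_iff_right hm,
    hasFiniteIntegral_iff_ofReal (ae_of_all _ fun ω => (Real.exp_pos _).le), lt_top_iff_ne_top,
    expMoment]

theorem integral_exp_eq_toReal {X : Ω → ℝ} (hX : AEStronglyMeasurable X Q) :
    ∫ ω, Real.exp (X ω) ∂Q = (expMoment Q X).toReal :=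
  integral_eq_lintegral_of_nonneg_ae (ae_of_all _ fun _ => (Real.exp_pos _).le)
    (Real.continuous_exp.comp_aestronglyMeasurable hX)

theorem expMoment_add_of_indep {Ω : Type*} {m₁ m₂ mΩ : MeasurableSpace Ω} {Q : Measure Ω}
    (hm₁ : m₁ ≤ mΩ) (hm₂ : m₂ ≤ mΩ) (h : Indep m₁ m₂ Q) {X Y : Ω → ℝ} (hX :
        AEStronglyMeasurable[m₁] X Q)
    (hY : AEStronglyMeasurable[m₂] Y Q) :
    expMoment Q (fun ω => X ω + Y ω) = expMoment Q X * expMoment Q Y := by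
  obtain ⟨X', hX', hXX'⟩ := hX
  obtain ⟨Y', hY', hYY'⟩ := hY
  have hXY : (fun ω => X ω + Y ω) =ᵐ[Q] fun ω => X' ω + Y' ω := by
    filter_upwards [hXX', hYY'] with ω h1 h2 using by rw [h1, h2]
  rw [expMoment_congr hXX', expMoment_congr hYY', expMoment_congr hXY]
  simp only [expMoment, Real.exp_add, ENNReal.ofReal_mul (Real.exp_pos _).le]
  exact lintegral_mul_eq_lintegral_mul_lintegral_of_independent_measurableSpace hm₁ hm₂ h
    (ENNReal.measurable_ofReal.comp (Real.measurable_exp.comp hX'.measurable))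
    (ENNReal.measurable_ofReal.comp (Real.measurable_exp.comp hY'.measurable))

theorem expMoment_le_liminf [IsFiniteMeasure Q] {X : ℕ → Ω → ℝ} {Y : Ω → ℝ}
    (hX : ∀ n, AEStronglyMeasurable (X n) Q)
    (h : ∀ᵐ ω ∂Q, Tendsto (fun n => X n ω) atTop (𝓝 (Y ω))) :
    expMoment Q Y ≤ liminf (fun n => expMoment Q (X n)) atTop := by
  refine le_trans (le_of_eq (lintegral_congr_ae ?_)) (lintegral_liminf_le' fun n =>
    ((Real.continuous_exp.comp_aestronglyMeasurable (hX n)).aemeasurable.ennreal_ofReal))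
  filter_upwards [h] with ω hω
  exact (((ENNReal.continuous_ofReal.comp Real.continuous_exp).tendsto _).comp hω).liminf_eq.symm

variable [IsProbabilityMeasure Q] {L : ℝ → Ω → Fin k → ℝ}

/-- From exp x ≥ 1 + x. This puts every logarithm of a moment of a centred variable in [0, ∞]. -/
theorem one_le_expMoment {X : Ω → ℝ} (hX : Integrable X Q) (h0 : ∫ ω, X ω ∂Q = 0) :
    1 ≤ expMoment Q X := by
  have h1 : ∫ ω, (X ω + 1) ∂Q = 1 := by
    rw [integral_add hX (integrable_const _), h0]
    simp
  calc (1 : ℝ≥0∞) = ENNReal.ofReal (∫ ω, (X ω + 1) ∂Q) := by rw [h1]; simp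
    _ ≤ ∫⁻ ω, ENNReal.ofReal (X ω + 1) ∂Q :=
        ofReal_integral_le_lintegral (hX.add (integrable_const _))
    _ ≤ expMoment Q X := lintegral_mono fun ω => ENNReal.ofReal_le_ofReal (Real.add_one_le_exp _)

theorem one_le_expMoment_incr (hsq : ∀ t, MemLp (L t) 2 Q) (hmean : ∀ t, ∫ ω, L t ω ∂Q = 0)
    (c : Fin k → ℝ) (p q : ℝ) : 1 ≤ expMoment Q (incr L c p q) :=
  one_le_expMoment ((memLp_incr hsq c p q).integrable (by norm_num)) (integral_incr hsq hmean c p q)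

/-- The `[0, ∞]`-valued cumulant `log E[exp (cᵀ L(1))]`. -/
noncomputable def extCumulant (Q : Measure Ω) (L : ℝ → Ω → Fin k → ℝ) (c : Fin k → ℝ) : ℝ≥0∞ :=
  logPos (expMoment Q fun ω => c ⬝ᵥ L 1 ω)

theorem extCumulant_zero : extCumulant Q L 0 = 0 := by
  simp [extCumulant, expMoment, logPos_one]

theorem IsTwoSidedLevy.identDistrib_sub_sub (hL : IsTwoSidedLevy Q L) {p q p' q' : ℝ} (hpq : p ≤ q)
    (h : q - p = q' - p') :
    IdentDistrib (fun ω => L q ω - L p ω) (fun ω => L q' ω - L p' ω) Q Q := by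
  have h2 := hL.identDistrib_sub (p := p') (q := q') (by linarith)
  rw [← h] at h2
  exact (hL.identDistrib_sub hpq).trans h2.symm

/-- Independence makes moments over adjacent intervals multiply, and stationarity leaves only the
length, so the log-moment is additive in the length. Additivity in [0, ∞] forces linearity even when
the moment is infinite. -/
theorem IsTwoSidedLevy.logPos_expMoment_incr (hL : IsTwoSidedLevy Q L)
    (hsq : ∀ t, MemLp (L t) 2 Q) (hmean : ∀ t, ∫ ω, L t ω ∂Q = 0) (c : Fin k → ℝ) {p q : ℝ}
    (hpq : p < q) :
    logPos (expMoment Q (incr L c p q)) = ENNReal.ofReal (q - p) * extCumulant Q L c := by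
  have hκ : ∀ p q, p ≤ q → expMoment Q (incr L c p q) = expMoment Q fun ω => c ⬝ᵥ L (q - p) ω :=
    fun p q hpq => expMoment_eq_of_identDistrib
      ((hL.identDistrib_sub hpq).comp (measurable_dotProduct_left c))
  have h := eq_ofReal_mul_of_additive (κ := fun s => logPos (expMoment Q fun ω => c ⬝ᵥ L s ω))
    (fun s t hs ht => ?_) (sub_pos.2 hpq)
  · rw [hκ p q hpq.le, h, extCumulant]
  · have e1 := hκ 0 (s + t) (by linarith)
    have e2 := hκ 0 s hs.le
    have e3 := hκ s (s + t) (by linarith)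
    rw [sub_zero] at e1 e2
    rw [add_sub_cancel_left] at e3
    rw [← e1, ← e2, ← e3, ← logPos_mul (one_le_expMoment_incr hsq hmean _ _ _)
      (one_le_expMoment_incr hsq hmean _ _ _)]
    congr 1
    rw [mul_comm, ← expMoment_add_of_indep
      (futureIncrements_le fun p _ => (hL.measurable p).sub (hL.measurable s))
      (pastIncrements_le fun p _ => (hL.measurable p).sub (hL.measurable s))
      (hL.indep_future_past s)
      (_root_.measurable_incr (measurable_futureIncrements L le_rfl
        (by linarith)) c).stronglyMeasurable.aestronglyMeasurable
      (_root_.measurable_incr (measurable_pastIncrements L hs.le le_rfl)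
        c).stronglyMeasurable.aestronglyMeasurable]
    congr 1
    ext1 ω
    rw [add_comm (incr L c s (s + t) ω), incr_add_incr]

/-- The joint law of an increment over a subinterval of `[a, b]` and of `L b - L a` depends only
on the length of the subinterval. -/
theorem IsTwoSidedLevy.identDistrib_incr_prod (hL : IsTwoSidedLevy Q L) {a b p q : ℝ}
    (hap : a ≤ p) (hpq : p ≤ q) (hqb : q ≤ b) :
    IdentDistrib (fun ω => (L q ω - L p ω, L b ω - L a ω))
      (fun ω => (L (a + (q - p)) ω - L a ω, L b ω - L a ω)) Q Q := by
  have hD : ∀ p q, Measurable fun ω => L q ω - L p ω := fun p q =>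
    (hL.measurable q).sub (hL.measurable p)
  -- The two pieces of (a, b] left after removing (p, q] are independent. Sliding the right piece to
  -- start at p keeps the joint law, and the sum becomes one increment of length (b - a) - (q - p).
  have hV : IdentDistrib (fun ω => (L p ω - L a ω) + (L b ω - L q ω))
      (fun ω => L b ω - L (a + (q - p)) ω) Q Q := by
    have h1 : IdentDistrib (fun ω => (L p ω - L a ω, L b ω - L q ω))
        (fun ω => (L p ω - L a ω, L (p + (b - q)) ω - L p ω)) Q Q := by
      refine IdentDistrib.prodMk (IdentDistrib.refl (hD _ _).aemeasurable)
        (hL.identDistrib_sub_sub hqb (by ring)) ?_ ?_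
      · exact ((hL.indep_future_past q).indepFun (measurable_futureIncrements L le_rfl hqb)
          (measurable_pastIncrements L (hap.trans hpq) hpq)).symm
      · exact ((hL.indep_future_past p).indepFun
          (measurable_futureIncrements L le_rfl (by linarith))
          (measurable_pastIncrements L hap le_rfl)).symm
    have h2 := h1.comp (u := fun x : (Fin k → ℝ) × (Fin k → ℝ) => x.1 + x.2) (by fun_prop)
    refine h2.trans ?_
    have h3 : ((fun x : (Fin k → ℝ) × (Fin k → ℝ) => x.1 + x.2) ∘
        fun ω => (L p ω - L a ω, L (p + (b - q)) ω - L p ω)) =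
        fun ω => L (p + (b - q)) ω - L a ω := by
      ext1 ω
      simp
    rw [h3]
    exact hL.identDistrib_sub_sub (by linarith) (by ring)
  have hind : IndepFun (fun ω => L q ω - L p ω) (fun ω => (L p ω - L a ω) + (L b ω - L q ω)) Q := by
    -- Step 1 is the middle increment, steps 0 and 2 are the two outer ones.
    let τ : ℕ → ℝ
      | 0 => a
      | 1 => p
      | 2 => q
      | _ => b
    have hτ : Monotone τ := by
      refine monotone_nat_of_le_succ fun n => ?_
      rcases n with _ | _ | _ | n
      exacts [hap, hpq, hqb, le_rfl]
    have := (hL.indep_increments.nat hτ).indepFun_add_right (fun i => hD _ _) 1 0 2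
      (by norm_num) (by norm_num)
    exact this
  have hind' : IndepFun (fun ω => L (a + (q - p)) ω - L a ω)
      (fun ω => L b ω - L (a + (q - p)) ω) Q :=
    ((hL.indep_future_past (a + (q - p))).indepFun
      (measurable_futureIncrements L le_rfl (by linarith))
      (measurable_pastIncrements L (by linarith) le_rfl)).symm
  have h := (IdentDistrib.prodMk (hL.identDistrib_sub_sub (p' := a) (q' := a + (q - p)) hpq
    (by ring)) hV hind hind').comp
    (u := fun x : (Fin k → ℝ) × (Fin k → ℝ) => (x.1, x.1 + x.2)) (by fun_prop)
  have e1 : ((fun x : (Fin k → ℝ) × (Fin k → ℝ) => (x.1, x.1 + x.2)) ∘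
      fun ω => (L q ω - L p ω, (L p ω - L a ω) + (L b ω - L q ω))) =
      fun ω => (L q ω - L p ω, L b ω - L a ω) := by
    ext1 ω
    simp only [Function.comp_apply]
    congr 1
    abel
  have e2 : ((fun x : (Fin k → ℝ) × (Fin k → ℝ) => (x.1, x.1 + x.2)) ∘
      fun ω => (L (a + (q - p)) ω - L a ω, L b ω - L (a + (q - p)) ω)) =
      fun ω => (L (a + (q - p)) ω - L a ω, L b ω - L a ω) := by
    ext1 ω
    simp
  rwa [e1, e2] at h

theorem integrable_memLp_mul_bounded {X : Ω → ℝ} (hX : MemLp X 2 Q) {Y : Ω → Fin k → ℝ}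
    (hY : Measurable Y) {F : (Fin k → ℝ) → ℝ} (hF : Measurable F) {B : ℝ} (hB : ∀ x, |F x| ≤ B) :
    Integrable (fun ω => X ω * F (Y ω)) Q :=
  (hX.integrable (by norm_num)).mul_bdd (c := B) (hF.comp hY).aestronglyMeasurable
    (ae_of_all _ fun ω => hB (Y ω))

/-- A tested form of E[L(q) - L(p) | L(b) - L(a)] = (q - p)/(b - a) · (L(b) - L(a)). By the
preceding joint law the left side depends only on q - p; it is additive and bounded in that length,
hence linear. -/
theorem IsTwoSidedLevy.integral_incr_mul_comp (hL : IsTwoSidedLevy Q L)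
    (hsq : ∀ t, MemLp (L t) 2 Q) (hmean : ∀ t, ∫ ω, L t ω ∂Q = 0)
    {F : (Fin k → ℝ) → ℝ} (hF : Measurable F) {B : ℝ} (hB : ∀ x, |F x| ≤ B) (c : Fin k → ℝ)
    {a b p q : ℝ} (hab : a < b) (hap : a ≤ p) (hpq : p ≤ q) (hqb : q ≤ b) :
    ∫ ω, incr L c p q ω * F (L b ω - L a ω) ∂Q =
      (q - p) / (b - a) * ∫ ω, incr L c a b ω * F (L b ω - L a ω) ∂Q := by
  have hD : Measurable fun ω => L b ω - L a ω := (hL.measurable b).sub (hL.measurable a)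
  have hI : ∀ p q, Integrable (fun ω => incr L c p q ω * F (L b ω - L a ω)) Q := fun p q =>
    integrable_memLp_mul_bounded (memLp_incr hsq c p q) hD hF hB
  set w : ℝ → ℝ := fun s => ∫ ω, incr L c a (a + s) ω * F (L b ω - L a ω) ∂Q with hw
  have hlaw : ∀ p q, a ≤ p → p ≤ q → q ≤ b →
      ∫ ω, incr L c p q ω * F (L b ω - L a ω) ∂Q = w (q - p) := by
    intro p q hap hpq hqb
    exact ((hL.identDistrib_incr_prod hap hpq hqb).comp
      (u := fun x : (Fin k → ℝ) × (Fin k → ℝ) => (c ⬝ᵥ x.1) * F x.2)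
      (((measurable_dotProduct_left c).comp measurable_fst).mul
        (hF.comp measurable_snd))).integral_eq
  have hB0 : 0 ≤ B := (abs_nonneg _).trans (hB 0)
  have hadd : ∀ s t, 0 ≤ s → 0 ≤ t → s + t ≤ b - a → w (s + t) = w s + w t := by
    intro s t hs ht hst
    have e := hlaw (a + s) (a + (s + t)) (by linarith) (by linarith) (by linarith)
    rw [show a + (s + t) - (a + s) = t by ring] at e
    rw [← e, hw]
    simp only
    rw [← integral_add (hI _ _) (hI _ _)]
    simp_rw [← add_mul, incr_add_incr]
  -- From |x| ≤ 1 + x² and the variance formula.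
  have hbd : ∀ s, 0 ≤ s → s ≤ b - a → |w s| ≤ (1 + (b - a) * incrCov Q L c c) * B := by
    intro s hs hsb
    have hsqi : Integrable (fun ω => incr L c a (a + s) ω * incr L c a (a + s) ω) Q :=
      integrable_incr_mul_incr hsq _ _ _ _ _ _
    calc |w s| ≤ ∫ ω, |incr L c a (a + s) ω * F (L b ω - L a ω)| ∂Q := abs_integral_le_integral_abs
      _ ≤ ∫ ω, (1 + incr L c a (a + s) ω * incr L c a (a + s) ω) * B ∂Q := by
          refine integral_mono (hI _ _).abs
            (((integrable_const 1).add hsqi).mul_const B) fun ω => ?_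
          simp only [abs_mul]
          refine mul_le_mul ?_ (hB _) (abs_nonneg _)
            (add_nonneg zero_le_one (mul_self_nonneg _))
          rw [abs_le]
          constructor <;> nlinarith [sq_nonneg (incr L c a (a + s) ω + 1),
            sq_nonneg (incr L c a (a + s) ω - 1), sq_nonneg (incr L c a (a + s) ω)]
      _ = (1 + s * incrCov Q L c c) * B := by
          rw [integral_mul_const, integral_add (integrable_const 1) hsqi,
            hL.integral_incr_mul_incr_self hsq hmean c c (by linarith)]
          simp
      _ ≤ _ := by
          have : 0 ≤ incrCov Q L c c := integral_nonneg fun ω => mul_self_nonneg _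
          gcongr
  rw [hlaw p q hap hpq hqb, hlaw a b le_rfl hab.le le_rfl]
  exact eq_div_mul_of_additive_of_bounded (sub_pos.2 hab) hadd hbd (sub_nonneg.2 hpq)
    (by linarith)

end ExpMoment

/-! ### Averaging the integrand over one cell -/

section Cell

variable {Ω : Type*} {k : ℕ} [mΩ : MeasurableSpace Ω] {Q : Measure Ω} [IsProbabilityMeasure Q]
  {L : ℝ → Ω → Fin k → ℝ}

theorem StepFunction.integral_eval (φ : StepFunction k) :
    ∫ s, φ.eval s = ∑ i, (φ.b i - φ.a i) • φ.c i := by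
  unfold StepFunction.eval
  rw [integral_finsetSum]
  · refine Finset.sum_congr rfl fun i _ => ?_
    rw [MeasureTheory.integral_indicator measurableSet_Ioc, setIntegral_const, Real.volume_real_Ioc,
      max_eq_left (sub_nonneg.2 (φ.a_le_b i))]
  · intro i _
    exact (integrable_indicator_iff measurableSet_Ioc).2
      (integrableOn_const (by simp) (by simp))

theorem exists_integral_incr_mul_eq (hL : IsTwoSidedLevy Q L) (hsq : ∀ t, MemLp (L t) 2 Q)
    {F : (Fin k → ℝ) → ℝ} (hF : Measurable F) {B : ℝ} (hB : ∀ x, |F x| ≤ B) (a b : ℝ) :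
    ∃ v : Fin k → ℝ, ∀ c, ∫ ω, incr L c a b ω * F (L b ω - L a ω) ∂Q = c ⬝ᵥ v := by
  have hD : Measurable fun ω => L b ω - L a ω := (hL.measurable b).sub (hL.measurable a)
  refine ⟨fun i => ∫ ω, (L b ω i - L a ω i) * F (L b ω - L a ω) ∂Q, fun c => ?_⟩
  have hi : ∀ i, Integrable (fun ω => (L b ω i - L a ω i) * F (L b ω - L a ω)) Q := fun i =>
    integrable_memLp_mul_bounded ((MemLp.eval (hsq b) i).sub (MemLp.eval (hsq a) i)) hD hF hB
  simp only [incr, dotProduct, Finset.sum_mul, Pi.sub_apply, mul_assoc]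
  rw [integral_finsetSum (f := fun i ω => c i * ((L b ω i - L a ω i) * F (L b ω - L a ω))) _
    fun i _ => (hi i).const_mul _]
  exact Finset.sum_congr rfl fun i _ => integral_const_mul _ _

/-- Against bounded functions of `L b - L a`, the integral of `f` over `(a, b]` may be replaced by
the integral of the average of `f`. -/
theorem IsLevyIntegral.integral_mul_comp (hL : IsTwoSidedLevy Q L) (hsq : ∀ t, MemLp (L t) 2 Q)
    (hmean : ∀ t, ∫ ω, L t ω ∂Q = 0) {f : ℝ → Fin k → ℝ} {I : Ω → ℝ} {a b : ℝ} (hab : a < b)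
    (hf : MemLp f 2 volume) (hI : IsLevyIntegral Q L ((Set.Ioc a b).indicator f) I)
    {F : (Fin k → ℝ) → ℝ} (hF : Measurable F) {B : ℝ} (hB : ∀ x, |F x| ≤ B) :
    ∫ ω, I ω * F (L b ω - L a ω) ∂Q =
      ∫ ω, incr L (⨍ s in Set.Ioc a b, f s) a b ω * F (L b ω - L a ω) ∂Q := by
  have hD : Measurable fun ω => L b ω - L a ω := (hL.measurable b).sub (hL.measurable a)
  obtain ⟨v, hv⟩ := exists_integral_incr_mul_eq hL hsq hF hB a b
  set φ : ℕ → StepFunction k := fun n => ((averageStep f n).above a).below b with hφ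
  have heval : ∀ n s, (φ n).eval s = (Set.Ioc a b).indicator (averageStep f n).eval s := by
    intro n s
    have : (StepFunction.eval ((averageStep f n).above a)) =
        (Set.Ioi a).indicator (averageStep f n).eval := funext (StepFunction.eval_above _ a)
    rw [hφ, StepFunction.eval_below, this, Set.indicator_indicator, ← Set.Ioi_inter_Iic,
      Set.inter_comm]
  have hlim : Tendsto (fun n => eLpNorm
      (fun s => (φ n).eval s - (Set.Ioc a b).indicator f s) 2 volume) atTop (𝓝 0) := by
    simp only [heval]
    exact IsLevyIntegral.tendsto_indicator _ (tendsto_averageStep hf)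
  have hlimI := IsLevyIntegral.tendsto hL hsq hmean (fun n => isLevyIntegral_step hsq (φ n)) hI hlim
  -- For a step function supported in (a, b] the tested integral depends only on ∫ φ. So it is
  -- enough that ∫ φₙ converges, which L² convergence gives since (a, b] has finite measure.
  have hstep : ∀ n, ∫ ω, (φ n).integral L ω * F (L b ω - L a ω) ∂Q =
      (b - a)⁻¹ * ((∫ s, (φ n).eval s) ⬝ᵥ v) := by
    intro n
    simp only [StepFunction.integral_eq_sum_incr, Finset.sum_mul]
    rw [integral_finsetSum _ fun i _ =>
        integrable_memLp_mul_bounded (memLp_incr hsq _ _ _) hD hF hB,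
      StepFunction.integral_eval, sum_dotProduct, Finset.mul_sum]
    refine Finset.sum_congr rfl fun i _ => ?_
    have h1 : a ≤ (φ n).a i := le_min (le_max_right _ _) hab.le
    have h2 : (φ n).b i ≤ b := min_le_right _ _
    rw [hL.integral_incr_mul_comp hsq hmean hF hB _ hab h1 ((φ n).a_le_b i) h2, hv,
      smul_dotProduct, smul_eq_mul]
    ring
  have hL1 : Tendsto (fun n => ∫ s, (φ n).eval s) atTop
      (𝓝 (∫ s, (Set.Ioc a b).indicator f s)) := by
    have hint : Integrable ((Set.Ioc a b).indicator f) volume :=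
      (integrable_indicator_iff measurableSet_Ioc).2 (integrableOn_Ioc_of_memLp hf a b)
    refine tendsto_integral_of_L1' _ hint.aestronglyMeasurable (Eventually.of_forall fun n =>
      memLp_one_iff_integrable.1 ((φ n).memLp_eval 1)) ?_
    have hC : volume (Set.Ioc a b) ^ (1 / (1 : ℝ≥0∞).toReal - 1 / (2 : ℝ≥0∞).toReal) ≠ ⊤ :=
      ENNReal.rpow_ne_top_of_nonneg (by norm_num) (by simp)
    have h0 := ENNReal.Tendsto.mul_const hlim (Or.inr hC)
    rw [zero_mul] at h0
    refine tendsto_of_tendsto_of_tendsto_of_le_of_le tendsto_const_nhds h0 (fun _ => zero_le)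
      fun n => ?_
    have e : (φ n).eval - (Set.Ioc a b).indicator f =
        (Set.Ioc a b).indicator fun s => (φ n).eval s - (Set.Ioc a b).indicator f s := by
      ext1 s
      by_cases hs : s ∈ Set.Ioc a b <;> simp [hs, heval]
    rw [e, eLpNorm_indicator_eq_eLpNorm_restrict measurableSet_Ioc]
    have hm : AEStronglyMeasurable (fun s => (φ n).eval s - (Set.Ioc a b).indicator f s) volume :=
      ((φ n).memLp_eval 2).aestronglyMeasurable.sub hint.aestronglyMeasurable
    refine (eLpNorm_le_eLpNorm_mul_rpow_measure_univ (p := 1) (q := 2) (by norm_num)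
      hm.restrict).trans ?_
    rw [Measure.restrict_apply_univ]
    gcongr
    exact Measure.restrict_le_self
  have hl : Tendsto (fun n => ∫ ω, (φ n).integral L ω * F (L b ω - L a ω) ∂Q) atTop
      (𝓝 ((b - a)⁻¹ * ((∫ s, (Set.Ioc a b).indicator f s) ⬝ᵥ v))) := by
    simp only [hstep]
    refine Tendsto.const_mul _ ?_
    have hcont : Continuous fun x : Fin k → ℝ => x ⬝ᵥ v := by
      unfold dotProduct
      fun_prop
    exact (hcont.tendsto _).comp hL1
  have hr : Tendsto (fun n => ∫ ω, (φ n).integral L ω * F (L b ω - L a ω) ∂Q) atTop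
      (𝓝 (∫ ω, I ω * F (L b ω - L a ω) ∂Q)) := by
    have hFm : AEStronglyMeasurable (fun ω => F (L b ω - L a ω)) Q :=
      (hF.comp hD).aestronglyMeasurable
    refine tendsto_integral_of_L1' _ (integrable_memLp_mul_bounded hI.2.1 hD hF
      hB).aestronglyMeasurable (Eventually.of_forall fun n =>
        integrable_memLp_mul_bounded ((φ n).memLp_integral hsq) hD hF hB) ?_
    have h0 := ENNReal.Tendsto.const_mul (a := ENNReal.ofReal B) hlimI
      (Or.inr ENNReal.ofReal_ne_top)
    rw [mul_zero] at h0
    refine tendsto_of_tendsto_of_tendsto_of_le_of_le tendsto_const_nhds h0 (fun _ => zero_le)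
      fun n => ?_
    have hm : AEStronglyMeasurable (fun ω => (φ n).integral L ω - I ω) Q :=
      (((φ n).memLp_integral hsq).sub hI.2.1).aestronglyMeasurable
    refine (eLpNorm_le_mul_eLpNorm_of_ae_le_mul (c := B)
      (g := fun ω => (φ n).integral L ω - I ω) (ae_of_all _ fun ω => ?_) 1).trans ?_
    · simp only [Pi.sub_apply, ← sub_mul, norm_mul, Real.norm_eq_abs]
      rw [mul_comm]
      gcongr
      exact hB _
    · gcongr
      exact eLpNorm_le_eLpNorm_of_exponent_le (by norm_num) hm
  rw [tendsto_nhds_unique hr hl, hv, MeasureTheory.integral_indicator measurableSet_Ioc,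
    setAverage_eq, Real.volume_real_Ioc, max_eq_left (sub_nonneg.2 hab.le), smul_dotProduct,
    smul_eq_mul]

/-- Monotone convergence. Truncation provides the bounded test functions and finite integrals needed
when the full moment may be infinite. -/
theorem tendsto_truncated_expMoment {X : Ω → ℝ} {N : Ω → ℝ} (hX : Measurable X)
    (hN : Measurable N) :
    Tendsto (fun n : ℕ => ∫⁻ ω, ENNReal.ofReal
      ({ω | N ω ≤ n}.indicator (fun ω => Real.exp (X ω)) ω) ∂Q) atTop (𝓝 (expMoment Q X)) := by
  refine lintegral_tendsto_of_tendsto_of_monotone (fun n => ?_) (ae_of_all _ fun ω => ?_)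
    (ae_of_all _ fun ω => ?_)
  · exact (((Real.measurable_exp.comp hX).indicator
      (measurableSet_le hN measurable_const)).ennreal_ofReal).aemeasurable
  · intro n m hnm
    refine ENNReal.ofReal_le_ofReal (Set.indicator_le_indicator_of_subset (fun ω hω => ?_)
      (fun ω => (Real.exp_pos _).le) ω)
    exact le_trans (show N ω ≤ n from hω) (Nat.cast_le.2 hnm)
  · obtain ⟨n₀, hn₀⟩ := exists_nat_ge (N ω)
    refine tendsto_const_nhds.congr' ?_
    filter_upwards [eventually_ge_atTop n₀] with n hn
    rw [Set.indicator_of_mem]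
    exact le_trans hn₀ (Nat.cast_le.2 hn)

/-- Averaging the integrand over a cell decreases the exponential moment. -/
theorem IsLevyIntegral.expMoment_average_le (hL : IsTwoSidedLevy Q L)
    (hsq : ∀ t, MemLp (L t) 2 Q) (hmean : ∀ t, ∫ ω, L t ω ∂Q = 0) {f : ℝ → Fin k → ℝ} {I : Ω → ℝ}
    {a b : ℝ} (hab : a < b) (hf : MemLp f 2 volume)
    (hI : IsLevyIntegral Q L ((Set.Ioc a b).indicator f) I) :
    expMoment Q (incr L (⨍ s in Set.Ioc a b, f s) a b) ≤ expMoment Q I := by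
  set c := ⨍ s in Set.Ioc a b, f s
  have hc := measurable_dotProduct_left c
  have hY : Measurable (incr L c a b) := hL.measurable_incr c a b
  refine le_of_tendsto' (tendsto_truncated_expMoment (Q := Q) hY hY.norm) fun n => ?_
  set F : (Fin k → ℝ) → ℝ := {x | ‖c ⬝ᵥ x‖ ≤ n}.indicator fun x => Real.exp (c ⬝ᵥ x) with hFdef
  have hF : Measurable F :=
    (Real.measurable_exp.comp hc).indicator (measurableSet_le hc.norm measurable_const)
  have hF0 : ∀ x, 0 ≤ F x := fun x => Set.indicator_nonneg (fun x _ => (Real.exp_pos _).le) x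
  have hB : ∀ x, |F x| ≤ Real.exp n := by
    intro x
    rw [abs_of_nonneg (hF0 x)]
    refine Set.indicator_le' (fun x hx => ?_) (fun _ _ => (Real.exp_pos _).le) x
    exact Real.exp_le_exp.2 ((le_abs_self _).trans hx)
  have hFω : ∀ ω, {ω | ‖incr L c a b ω‖ ≤ n}.indicator (fun ω => Real.exp (incr L c a b ω)) ω =
      F (L b ω - L a ω) := fun ω => rfl
  have hD : Measurable fun ω => L b ω - L a ω := (hL.measurable b).sub (hL.measurable a)
  have i1 : Integrable (fun ω => I ω * F (L b ω - L a ω)) Q :=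
    integrable_memLp_mul_bounded hI.2.1 hD hF hB
  have i2 : Integrable (fun ω => incr L c a b ω * F (L b ω - L a ω)) Q :=
    integrable_memLp_mul_bounded (memLp_incr hsq c a b) hD hF hB
  have i3 : Integrable (fun ω => F (L b ω - L a ω)) Q := by
    have := integrable_memLp_mul_bounded (Q := Q) (memLp_const (1 : ℝ)) hD hF hB
    simpa using this
  simp only [hFω]
  rw [← ofReal_integral_eq_lintegral_ofReal i3 (ae_of_all _ fun ω => hF0 _)]
  -- The added term has mean zero because I and the averaged increment agree against F. It turns F
  -- into the tangent line of exp at the averaged increment, which lies below exp(I).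
  have e : ∫ ω, F (L b ω - L a ω) ∂Q = ∫ ω, (F (L b ω - L a ω) +
      (I ω * F (L b ω - L a ω) - incr L c a b ω * F (L b ω - L a ω))) ∂Q := by
    rw [integral_add (g := fun ω => I ω * F (L b ω - L a ω) - incr L c a b ω * F (L b ω - L a ω))
      i3 (i1.sub i2), integral_sub i1 i2,
      hI.integral_mul_comp hL hsq hmean hab hf hF hB, sub_self, add_zero]
  rw [e]
  refine (ofReal_integral_le_lintegral (i3.add (i1.sub i2))).trans
    (lintegral_mono fun ω => ENNReal.ofReal_le_ofReal ?_)
  by_cases h : ‖c ⬝ᵥ (L b ω - L a ω)‖ ≤ n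
  · have hFe : F (L b ω - L a ω) = Real.exp (incr L c a b ω) :=
      Set.indicator_of_mem (s := {x | ‖c ⬝ᵥ x‖ ≤ n}) h _
    simp only [Pi.add_apply, Pi.sub_apply, hFe]
    calc _ = Real.exp (incr L c a b ω) * ((I ω - incr L c a b ω) + 1) := by ring
      _ ≤ Real.exp (incr L c a b ω) * Real.exp (I ω - incr L c a b ω) := by
          gcongr
          exact Real.add_one_le_exp _
      _ = Real.exp (I ω) := by rw [← Real.exp_add, add_sub_cancel]
  · have hFe : F (L b ω - L a ω) = 0 :=
      Set.indicator_of_notMem (s := {x | ‖c ⬝ᵥ x‖ ≤ n}) h _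
    simpa [hFe] using (Real.exp_pos (I ω)).le

end Cell

/-! ### Convexity and lower semicontinuity of the extended cumulant -/

section Cumulant

variable {Ω : Type*} {k : ℕ} [mΩ : MeasurableSpace Ω] {Q : Measure Ω} [IsProbabilityMeasure Q]
  {L : ℝ → Ω → Fin k → ℝ}

/-- Jensen's inequality for the extended cumulant. -/
theorem extCumulant_average_le (hmeas : Measurable (L 1)) {f : ℝ → Fin k → ℝ}
    {a b : ℝ} (hab : a < b) (hf : IntegrableOn f (Set.Ioc a b)) :
    ENNReal.ofReal (b - a) * extCumulant Q L (⨍ s in Set.Ioc a b, f s) ≤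
      ∫⁻ s in Set.Ioc a b, extCumulant Q L (f s) := by
  set c := ⨍ s in Set.Ioc a b, f s with hc
  set Y := L 1 with hY
  have hcY : Measurable fun ω => c ⬝ᵥ Y ω := (measurable_dotProduct_left c).comp hmeas
  have hlim := (ENNReal.Tendsto.const_mul (a := ENNReal.ofReal (b - a))
    ((continuous_logPos.tendsto _).comp (tendsto_truncated_expMoment (Q := Q) hcY hmeas.norm))
    (Or.inr ENNReal.ofReal_ne_top))
  refine le_of_tendsto' hlim fun n => ?_
  set w : Ω → ℝ := {ω | ‖Y ω‖ ≤ n}.indicator fun ω => Real.exp (c ⬝ᵥ Y ω) with hw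
  have hwm : Measurable w := (Real.measurable_exp.comp hcY).indicator
    (measurableSet_le hmeas.norm measurable_const)
  have hw0 : ∀ ω, 0 ≤ w ω := fun ω => Set.indicator_nonneg (fun ω _ => (Real.exp_pos _).le) ω
  have hwin : ∀ ω, ‖Y ω‖ ≤ n → w ω = Real.exp (c ⬝ᵥ Y ω) := fun ω h =>
    Set.indicator_of_mem (s := {ω | ‖Y ω‖ ≤ n}) h _
  have hwout : ∀ ω, ¬ ‖Y ω‖ ≤ n → w ω = 0 := fun ω h =>
    Set.indicator_of_notMem (s := {ω | ‖Y ω‖ ≤ n}) h _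
  have hwY : ∀ d : Fin k → ℝ, Integrable (fun ω => w ω * (d ⬝ᵥ Y ω)) Q := by
    intro d
    refine Integrable.of_bound (C := Real.exp (k * (‖c‖ * n)) * (k * (‖d‖ * n)))
      (hwm.mul ((measurable_dotProduct_left d).comp hmeas)).aestronglyMeasurable
      (ae_of_all _ fun ω => ?_)
    by_cases h : ‖Y ω‖ ≤ n
    · have := hwin ω h
      rw [norm_mul, this, Real.norm_eq_abs, Real.norm_eq_abs, Real.abs_exp]
      gcongr
      · exact (le_abs_self _).trans ((abs_dotProduct_le c (Y ω)).trans (by gcongr))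
      · exact (abs_dotProduct_le d (Y ω)).trans (by gcongr)
    · have := hwout ω h
      rw [this, zero_mul, norm_zero]
      positivity
  have hwi : Integrable w Q := by
    refine Integrable.of_bound (C := Real.exp (k * (‖c‖ * n))) hwm.aestronglyMeasurable
      (ae_of_all _ fun ω => ?_)
    by_cases h : ‖Y ω‖ ≤ n
    · have := hwin ω h
      rw [this, Real.norm_eq_abs, Real.abs_exp]
      gcongr
      exact (le_abs_self _).trans ((abs_dotProduct_le c (Y ω)).trans (by gcongr))
    · have := hwout ω h
      rw [this, norm_zero]
      positivity
  set Z := ∫ ω, w ω ∂Q with hZ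
  have hZeq : ∫⁻ ω, ENNReal.ofReal (w ω) ∂Q = ENNReal.ofReal Z :=
    (ofReal_integral_eq_lintegral_ofReal hwi (ae_of_all _ hw0)).symm
  simp only [Function.comp_apply]
  rw [hZeq]
  have hZn : 0 ≤ Z := integral_nonneg hw0
  -- If the truncated mass is 0, `logPos` sends it to 0 and there is nothing to prove.
  rcases hZn.eq_or_lt with hZ0 | hZ0
  · rw [← hZ0]
    simp [logPos]
  rw [logPos_ofReal hZ0, ← ENNReal.ofReal_mul (sub_nonneg.2 hab.le)]
  -- The mean of Y under the probability with density w / Z: the slope at c of the truncated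
  -- cumulant.
  set v : Fin k → ℝ := fun i => Z⁻¹ * ∫ ω, w ω * Y ω i ∂Q with hv
  have hdv : ∀ d : Fin k → ℝ, ∫ ω, w ω * (d ⬝ᵥ Y ω) ∂Q = Z * (d ⬝ᵥ v) := by
    intro d
    have h1 : ∀ i, Integrable (fun ω => w ω * Y ω i) Q := by
      intro i
      have := hwY (Pi.single i 1)
      simpa using this
    simp only [dotProduct, Finset.mul_sum, hv]
    rw [integral_finsetSum]
    · refine Finset.sum_congr rfl fun i _ => ?_
      have : ∀ ω, w ω * (d i * Y ω i) = d i * (w ω * Y ω i) := fun ω => by ring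
      simp only [this]
      rw [integral_const_mul]
      field_simp [hZ0.ne']
    · intro i _
      have : ∀ ω, w ω * (d i * Y ω i) = d i * (w ω * Y ω i) := fun ω => by ring
      simp only [this]
      exact (h1 i).const_mul _
  -- An affine minorant of the cumulant, by Jensen for the tilted probability (tangent of exp at
  -- x₀). Integrated over the cell, its linear part vanishes because c is the average of f. This
  -- needs no differentiability or finiteness of the cumulant.
  have key : ∀ y : Fin k → ℝ,
      ENNReal.ofReal (Real.log Z + (y - c) ⬝ᵥ v) ≤ extCumulant Q L y := by
    intro y
    set x₀ := (y - c) ⬝ᵥ v with hx₀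
    have hlog : Real.log Z + x₀ = Real.log (Z * Real.exp x₀) := by
      rw [Real.log_mul hZ0.ne' (Real.exp_ne_zero _), Real.log_exp]
    rw [hlog, ← logPos_ofReal (by positivity)]
    refine logPos_mono ?_
    have hi : Integrable (fun ω => Real.exp x₀ * (w ω * ((y - c) ⬝ᵥ Y ω) + (1 - x₀) * w ω)) Q :=
      ((hwY (y - c)).add (hwi.const_mul _)).const_mul _
    have e : Z * Real.exp x₀ =
        ∫ ω, Real.exp x₀ * (w ω * ((y - c) ⬝ᵥ Y ω) + (1 - x₀) * w ω) ∂Q := by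
      rw [integral_const_mul, integral_add (hwY _) (hwi.const_mul _), hdv, integral_const_mul,
        ← hZ, ← hx₀]
      ring
    rw [e]
    refine (ofReal_integral_le_lintegral hi).trans
      (lintegral_mono fun ω => ENNReal.ofReal_le_ofReal ?_)
    by_cases h : ‖Y ω‖ ≤ n
    · have := hwin ω h
      rw [this]
      calc _ = Real.exp (c ⬝ᵥ Y ω) * (Real.exp x₀ * (((y - c) ⬝ᵥ Y ω - x₀) + 1)) := by ring
        _ ≤ Real.exp (c ⬝ᵥ Y ω) * (Real.exp x₀ * Real.exp ((y - c) ⬝ᵥ Y ω - x₀)) := by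
            gcongr
            exact Real.add_one_le_exp _
        _ = Real.exp (y ⬝ᵥ Y ω) := by
            rw [← Real.exp_add, ← Real.exp_add, sub_dotProduct]
            congr 1
            ring
    · have := hwout ω h
      simpa [this] using (Real.exp_pos (y ⬝ᵥ Y ω)).le
  have hvol : volume.real (Set.Ioc a b) = b - a := by
    rw [Real.volume_real_Ioc, max_eq_left (sub_nonneg.2 hab.le)]
  have hcoord : ∀ i, IntegrableOn (fun s => (f s - c) i * v i) (Set.Ioc a b) := fun i =>
    ((Integrable.eval hf i).sub (integrable_const (c i))).mul_const _
  have hdi : IntegrableOn (fun s => (f s - c) ⬝ᵥ v) (Set.Ioc a b) := by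
    simp only [dotProduct]
    exact integrable_finsetSum _ fun i _ => hcoord i
  have hd0 : ∫ s in Set.Ioc a b, (f s - c) ⬝ᵥ v = 0 := by
    simp only [dotProduct]
    rw [integral_finsetSum _ fun i _ => hcoord i]
    refine Finset.sum_eq_zero fun i _ => ?_
    rw [integral_mul_const]
    have h2 : ∫ s in Set.Ioc a b, (f s - c) i = 0 := by
      simp only [Pi.sub_apply]
      rw [integral_sub (Integrable.eval hf i) (integrable_const (c i)), setIntegral_const, hvol,
        ← eval_integral (fun i => Integrable.eval hf i) i, hc, setAverage_eq, hvol]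
      simp [(sub_pos.2 hab).ne']
    rw [h2, zero_mul]
  calc ENNReal.ofReal ((b - a) * Real.log Z)
      = ENNReal.ofReal (∫ s in Set.Ioc a b, (Real.log Z + (f s - c) ⬝ᵥ v)) := by
        rw [integral_add (integrable_const _) hdi, hd0, setIntegral_const, hvol]
        simp
    _ ≤ ∫⁻ s in Set.Ioc a b, ENNReal.ofReal (Real.log Z + (f s - c) ⬝ᵥ v) :=
        ofReal_integral_le_lintegral ((integrable_const _).add hdi)
    _ ≤ _ := lintegral_mono fun s => key (f s)

/-- Fatou's lemma. Semicontinuity is all that is needed, and the cumulant may well jump to ∞. -/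
theorem extCumulant_le_liminf (hmeas : Measurable (L 1)) {y : ℕ → Fin k → ℝ} {x : Fin k → ℝ}
    (h : Tendsto y atTop (𝓝 x)) :
    extCumulant Q L x ≤ liminf (fun n => extCumulant Q L (y n)) atTop := by
  have hc : ∀ z : Fin k → ℝ, Continuous fun y : Fin k → ℝ => y ⬝ᵥ z := fun z => by
    unfold dotProduct
    fun_prop
  have h1 : expMoment Q (fun ω => x ⬝ᵥ L 1 ω) ≤
      liminf (fun n => expMoment Q fun ω => y n ⬝ᵥ L 1 ω) atTop :=
    expMoment_le_liminf (fun n => ((measurable_dotProduct_left (y n)).comp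
      hmeas).aestronglyMeasurable) (ae_of_all _ fun ω => ((hc (L 1 ω)).tendsto x).comp h)
  refine (logPos_mono h1).trans (le_of_eq ?_)
  exact logPos_mono.map_liminf_of_continuousAt _ continuous_logPos.continuousAt

theorem measurable_extCumulant (hmeas : Measurable (L 1)) : Measurable (extCumulant Q L) := by
  refine continuous_logPos.measurable.comp (Measurable.lintegral_prod_right'
    (f := fun p : (Fin k → ℝ) × Ω => ENNReal.ofReal (Real.exp (p.1 ⬝ᵥ L 1 p.2))) ?_)
  unfold dotProduct
  have : Measurable fun p : (Fin k → ℝ) × Ω => ∑ i, p.1 i * L 1 p.2 i := by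
    have h2 : Measurable fun p : (Fin k → ℝ) × Ω => L 1 p.2 := hmeas.comp measurable_snd
    exact Finset.measurable_sum _ fun i _ => ((measurable_pi_apply i).comp measurable_fst).mul
      ((measurable_pi_apply i).comp h2)
  exact (Real.measurable_exp.comp this).ennreal_ofReal

end Cumulant

/-! ### The cumulant of a stochastic integral -/

section LevyCumulant

variable {Ω : Type*} {k : ℕ} [mΩ : MeasurableSpace Ω] {Q : Measure Ω} [IsProbabilityMeasure Q]
  {L : ℝ → Ω → Fin k → ℝ}

/-- The `[0, ∞]`-valued cumulant `log E[exp (∫ fᵀ dL)]` of a stochastic integral. -/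
noncomputable def levyCumulant (Q : Measure Ω) (L : ℝ → Ω → Fin k → ℝ) (f : ℝ → Fin k → ℝ) :
    ℝ≥0∞ :=
  logPos (expMoment Q (levyIntegral Q L f))

theorem IsLevyIntegral.one_le_expMoment (hsq : ∀ t, MemLp (L t) 2 Q)
    (hmean : ∀ t, ∫ ω, L t ω ∂Q = 0) {f : ℝ → Fin k → ℝ} {I : Ω → ℝ}
    (hI : IsLevyIntegral Q L f I) : 1 ≤ expMoment Q I :=
  _root_.one_le_expMoment (hI.2.1.integrable (by norm_num)) (hI.integral_eq_zero hsq hmean)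

theorem IsLevyIntegral.levyCumulant_eq (hL : IsTwoSidedLevy Q L) (hsq : ∀ t, MemLp (L t) 2 Q)
    (hmean : ∀ t, ∫ ω, L t ω ∂Q = 0) {f g : ℝ → Fin k → ℝ} {I : Ω → ℝ}
    (hI : IsLevyIntegral Q L g I) (h : f =ᵐ[volume] g) :
    levyCumulant Q L f = logPos (expMoment Q I) := by
  have hf : MemLp f 2 volume := hI.1.ae_eq h.symm
  rw [levyCumulant, expMoment_congr
    ((IsLevyIntegral.levyIntegral hL hsq hmean hf).ae_eq hL hsq hmean hI h)]

theorem levyCumulant_zero (hL : IsTwoSidedLevy Q L) (hsq : ∀ t, MemLp (L t) 2 Q)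
    (hmean : ∀ t, ∫ ω, L t ω ∂Q = 0) : levyCumulant Q L (fun _ => 0) = 0 := by
  have h := (isLevyIntegral_step hsq (StepFunction.single (le_refl (0 : ℝ)) 0)).levyCumulant_eq
    hL hsq hmean (f := fun _ => 0) (ae_of_all _ fun s => by simp [StepFunction.eval_single])
  rw [h]
  have : (StepFunction.single (k := k) (le_refl (0 : ℝ)) 0).integral L = fun _ => 0 := by
    ext1 ω
    simp [StepFunction.integral_single, incr]
  simp [this, expMoment, logPos_one]

/-- The integrals over (-∞, a] and (a, ∞) are measurable for past and future increments at a, hence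
independent. Both moments are at least 1, so `logPos` turns their product into a sum. -/
theorem levyCumulant_split (hL : IsTwoSidedLevy Q L) (hsq : ∀ t, MemLp (L t) 2 Q)
    (hmean : ∀ t, ∫ ω, L t ω ∂Q = 0) {f : ℝ → Fin k → ℝ} (hf : MemLp f 2 volume) (a : ℝ) :
    levyCumulant Q L f =
      levyCumulant Q L ((Set.Iic a).indicator f) + levyCumulant Q L ((Set.Ioi a).indicator f) := by
  have h1 := IsLevyIntegral.levyIntegral hL hsq hmean (hf.indicator (measurableSet_Iic (a := a)))
  have h2 := IsLevyIntegral.levyIntegral hL hsq hmean (hf.indicator (measurableSet_Ioi (a := a)))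
  have hfut : futureIncrements L a ≤ mΩ :=
    futureIncrements_le fun p _ => (hL.measurable p).sub (hL.measurable a)
  have hpast : pastIncrements L a ≤ mΩ :=
    pastIncrements_le fun p _ => (hL.measurable p).sub (hL.measurable a)
  rw [(h1.add hsq h2).levyCumulant_eq hL hsq hmean (ae_of_all _ fun s => ?_),
    expMoment_add_of_indep hpast hfut (hL.indep_future_past a).symm
      (h1.aestronglyMeasurable_of_indicator_Iic hL hsq hmean hf hpast
        fun p q hp hq => measurable_pastIncrements L hp hq)
      (h2.aestronglyMeasurable_of_indicator_Ioi hL hsq hmean hf),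
    logPos_mul (h1.one_le_expMoment hsq hmean) (h2.one_le_expMoment hsq hmean)]
  · rfl
  · by_cases hs : s ≤ a
    · simp [hs]
    · simp [hs, not_le.1 hs]

theorem levyCumulant_grid (hL : IsTwoSidedLevy Q L) (hsq : ∀ t, MemLp (L t) 2 Q)
    (hmean : ∀ t, ∫ ω, L t ω ∂Q = 0) {f : ℝ → Fin k → ℝ} (hf : MemLp f 2 volume) {u : ℕ → ℝ}
    (hu : Monotone u) (N : ℕ) :
    levyCumulant Q L ((Set.Ioi (u 0)).indicator f) =
      ∑ i ∈ Finset.range N, levyCumulant Q L ((Set.Ioc (u i) (u (i + 1))).indicator f) +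
        levyCumulant Q L ((Set.Ioi (u N)).indicator f) := by
  induction N with
  | zero => simp
  | succ N ih =>
    rw [ih, Finset.sum_range_succ, add_assoc]
    congr 1
    rw [levyCumulant_split hL hsq hmean (hf.indicator measurableSet_Ioi) (u (N + 1)),
      Set.indicator_indicator, Set.indicator_indicator, Set.inter_comm, Set.Ioi_inter_Iic,
      Set.Ioi_inter_Ioi, sup_eq_left.2 (hu N.le_succ)]

theorem levyCumulant_indicator_const (hL : IsTwoSidedLevy Q L) (hsq : ∀ t, MemLp (L t) 2 Q)
    (hmean : ∀ t, ∫ ω, L t ω ∂Q = 0) {a b : ℝ} (hab : a ≤ b) (c : Fin k → ℝ) :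
    levyCumulant Q L ((Set.Ioc a b).indicator fun _ => c) =
      ENNReal.ofReal (b - a) * extCumulant Q L c := by
  rcases hab.eq_or_lt with rfl | h
  · simpa using levyCumulant_zero hL hsq hmean
  rw [(isLevyIntegral_step hsq (StepFunction.single hab c)).levyCumulant_eq hL hsq hmean
    (ae_of_all _ fun s => (StepFunction.eval_single hab c s).symm),
    ← hL.logPos_expMoment_incr hsq hmean c h]
  congr 2
  exact funext (StepFunction.integral_single hab c)

theorem ofReal_mul_extCumulant_average_le (hL : IsTwoSidedLevy Q L) (hsq : ∀ t, MemLp (L t) 2 Q)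
    (hmean : ∀ t, ∫ ω, L t ω ∂Q = 0) {f : ℝ → Fin k → ℝ} (hf : MemLp f 2 volume) {a b : ℝ}
    (hab : a ≤ b) : ENNReal.ofReal (b - a) * extCumulant Q L (⨍ s in Set.Ioc a b, f s) ≤
      levyCumulant Q L ((Set.Ioc a b).indicator f) := by
  rcases hab.eq_or_lt with rfl | h
  · simp
  rw [← hL.logPos_expMoment_incr hsq hmean _ h]
  exact logPos_mono ((IsLevyIntegral.levyIntegral hL hsq hmean
    (hf.indicator measurableSet_Ioc)).expMoment_average_le hL hsq hmean h hf)

/-- The cellwise inequality is summed; the cumulants of the two tails outside the grid are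
nonnegative and are dropped. -/
theorem lintegral_extCumulant_averageStep_le (hL : IsTwoSidedLevy Q L)
    (hsq : ∀ t, MemLp (L t) 2 Q) (hmean : ∀ t, ∫ ω, L t ω ∂Q = 0) {f : ℝ → Fin k → ℝ}
    (hf : MemLp f 2 volume) (n : ℕ) :
    ∫⁻ s, extCumulant Q L ((averageStep f n).eval s) ≤ levyCumulant Q L f := by
  have hu := monotone_uniformGrid n
  rw [averageStep, lintegral_comp_gridAverage f hu _ extCumulant_zero,
    levyCumulant_split hL hsq hmean hf (uniformGrid n 0),
    levyCumulant_grid hL hsq hmean hf hu (2 * (n + 1) ^ 2)]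
  refine le_trans ?_ (le_add_self.trans' le_self_add)
  exact Finset.sum_le_sum fun i _ =>
    ofReal_mul_extCumulant_average_le hL hsq hmean hf (hu i.le_succ)

/-- For the averaged integrand the cumulant is exactly the sum over the cells, and Jensen for ψ
compares that sum with ∫ ψ(f). -/
theorem levyCumulant_averageStep_le (hL : IsTwoSidedLevy Q L)
    (hsq : ∀ t, MemLp (L t) 2 Q) (hmean : ∀ t, ∫ ω, L t ω ∂Q = 0) {f : ℝ → Fin k → ℝ}
    (hf : MemLp f 2 volume) (n : ℕ) :
    levyCumulant Q L (averageStep f n).eval ≤ ∫⁻ s, extCumulant Q L (f s) := by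
  have hu := monotone_uniformGrid n
  have hA := (averageStep f n).memLp_eval 2
  refine le_trans (le_of_eq ?_) (lintegral_comp_gridAverage_le f hu (2 * (n + 1) ^ 2)
    extCumulant_zero fun a b hab => extCumulant_average_le (hL.measurable 1) hab
      (integrableOn_Ioc_of_memLp hf a b))
  rw [lintegral_comp_gridAverage f hu _ extCumulant_zero,
    levyCumulant_split hL hsq hmean hA (uniformGrid n 0),
    levyCumulant_grid hL hsq hmean hA hu (2 * (n + 1) ^ 2)]
  have h1 : (Set.Iic (uniformGrid n 0)).indicator (averageStep f n).eval = fun _ => 0 := by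
    ext1 s
    refine Set.indicator_apply_eq_zero.2 fun hs => gridAverage_eval_of_notMem f hu fun h => ?_
    exact h.1.not_ge hs
  have h2 : (Set.Ioi (uniformGrid n (2 * (n + 1) ^ 2))).indicator (averageStep f n).eval =
      fun _ => 0 := by
    ext1 s
    refine Set.indicator_apply_eq_zero.2 fun hs => gridAverage_eval_of_notMem f hu fun h => ?_
    exact h.2.not_gt hs
  rw [h1, h2, levyCumulant_zero hL hsq hmean, zero_add, add_zero]
  refine Finset.sum_congr rfl fun i hi => ?_
  rw [← levyCumulant_indicator_const hL hsq hmean (hu i.le_succ)]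
  congr 1
  ext1 s
  by_cases hs : s ∈ Set.Ioc (uniformGrid n i) (uniformGrid n (i + 1))
  · rw [Set.indicator_of_mem hs, Set.indicator_of_mem hs]
    exact gridAverage_eval_of_mem f hu (Finset.mem_range.1 hi) hs
  · rw [Set.indicator_of_notMem hs, Set.indicator_of_notMem hs]

/-- The cumulant of `∫ fᵀ dL` is the integral of the cumulant of `L(1)` along `f`. -/
theorem levyCumulant_eq_lintegral (hL : IsTwoSidedLevy Q L)
    (hsq : ∀ t, MemLp (L t) 2 Q) (hmean : ∀ t, ∫ ω, L t ω ∂Q = 0) {f : ℝ → Fin k → ℝ}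
    (hf : MemLp f 2 volume) : levyCumulant Q L f = ∫⁻ s, extCumulant Q L (f s) := by
  have hlim := tendsto_averageStep hf
  apply le_antisymm
  -- Upper bound: Fatou on Ω along an a.s. convergent subsequence of the approximating integrals.
  · have hI := IsLevyIntegral.levyIntegral hL hsq hmean hf
    have hIn := fun n => isLevyIntegral_step hsq (averageStep f n)
    have h1 := IsLevyIntegral.tendsto hL hsq hmean hIn hI hlim
    obtain ⟨ns, -, hns⟩ := (tendstoInMeasure_of_tendsto_eLpNorm (p := 2) (by norm_num)
      (fun n => (hIn n).2.1.aestronglyMeasurable) hI.2.1.aestronglyMeasurable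
      h1).exists_seq_tendsto_ae
    have h2 := expMoment_le_liminf (fun n => (hIn (ns n)).2.1.aestronglyMeasurable) hns
    refine (logPos_mono h2).trans ?_
    rw [logPos_mono.map_liminf_of_continuousAt _ continuous_logPos.continuousAt]
    refine (liminf_le_liminf (v := fun _ => ∫⁻ s, extCumulant Q L (f s))
      (Eventually.of_forall fun n => ?_)).trans (liminf_const _).le
    have h3 := (hIn (ns n)).levyCumulant_eq hL hsq hmean (ae_eq_refl _)
    rw [Function.comp_apply, ← h3]
    exact levyCumulant_averageStep_le hL hsq hmean hf _
  -- Lower bound: semicontinuity of the cumulant and Fatou on the time axis, along an a.e.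
  -- convergent subsequence of the averages.
  · obtain ⟨ns, -, hns⟩ := (tendstoInMeasure_of_tendsto_eLpNorm (p := 2) (by norm_num)
      (fun n => ((averageStep f n).memLp_eval 2).aestronglyMeasurable) hf.aestronglyMeasurable
      hlim).exists_seq_tendsto_ae
    calc ∫⁻ s, extCumulant Q L (f s)
        ≤ ∫⁻ s, liminf (fun n => extCumulant Q L ((averageStep f (ns n)).eval s)) atTop := by
          refine lintegral_mono_ae ?_
          filter_upwards [hns] with s hs using extCumulant_le_liminf (hL.measurable 1) hs
      _ ≤ liminf (fun n => ∫⁻ s, extCumulant Q L ((averageStep f (ns n)).eval s)) atTop :=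
          lintegral_liminf_le' fun n => (measurable_extCumulant
            (hL.measurable 1)).comp_aemeasurable
              ((averageStep f (ns n)).memLp_eval 2).aestronglyMeasurable.aemeasurable
      _ ≤ levyCumulant Q L f := by
          refine (liminf_le_liminf (v := fun _ => levyCumulant Q L f)
            (Eventually.of_forall fun n => ?_)).trans (liminf_const _).le
          exact lintegral_extCumulant_averageStep_le hL hsq hmean hf _

end LevyCumulant

/-! ### Kernel integrals and conditioning -/

section Kernel

variable {Ω : Type*} {m k : ℕ} [mΩ : MeasurableSpace Ω] {Q : Measure Ω} [IsProbabilityMeasure Q]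
  {L : ℝ → Ω → Fin k → ℝ} {G : ℝ → Matrix (Fin m) (Fin k) ℝ}

/-- If the moment is infinite both sides are 0, since the Bochner integral and `Real.log 0` are 0.
If it is finite, it is at least 1 and the truncation in `logPos` has no effect. -/
theorem logPos_expMoment_toReal {X : Ω → ℝ} (hX : AEStronglyMeasurable X Q)
    (h1 : 1 ≤ expMoment Q X) :
    Real.log (∫ ω, Real.exp (X ω) ∂Q) = (logPos (expMoment Q X)).toReal := by
  rw [integral_exp_eq_toReal hX]
  rcases eq_or_ne (expMoment Q X) ⊤ with h | h
  · rw [logPos_eq_top_iff.2 h, h]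
    simp
  · have h2 : 1 ≤ (expMoment Q X).toReal := by
      simpa using (ENNReal.toReal_le_toReal ENNReal.one_ne_top h).2 h1
    conv_rhs => rw [← ENNReal.ofReal_toReal h]
    rw [logPos_ofReal (by linarith), ENNReal.toReal_ofReal (Real.log_nonneg h2)]

theorem cumulant_eq_toReal (hL : IsTwoSidedLevy Q L) (hsq : ∀ t, MemLp (L t) 2 Q)
    (hmean : ∀ t, ∫ ω, L t ω ∂Q = 0) (y : Fin k → ℝ) :
    cumulant Q (L 1) y = (extCumulant Q L y).toReal := by
  refine logPos_expMoment_toReal (memLp_dotProduct (hsq 1) y).aestronglyMeasurable ?_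
  refine (one_le_expMoment_incr hsq hmean y 0 1).trans (le_of_eq (expMoment_congr ?_))
  filter_upwards [hL.zero] with ω hω
  simp [incr, hω]

theorem memLp_indicator_kernel
    (hG : ∀ i j, MemLp (fun u => G u i j) 2 (volume.restrict (Set.Ici (0 : ℝ)))) {t T : ℝ}
    (htT : t ≤ T) (i : Fin m) :
    MemLp ((Set.Iic t).indicator fun s => G (T - s) i) 2 volume := by
  have h1 : MemLp (fun u => G u i) 2 (volume.restrict (Set.Ici (0 : ℝ))) := memLp_pi_iff.2 (hG i)
  have h2 := ((memLp_indicator_iff_restrict measurableSet_Ici).2 h1).comp_measurePreserving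
    (Measure.measurePreserving_sub_left volume T)
  have h3 := h2.indicator (measurableSet_Iic (a := t))
  refine h3.ae_eq (ae_of_all _ fun s => ?_)
  by_cases hs : s ∈ Set.Iic t
  · have : T - s ∈ Set.Ici (0 : ℝ) := sub_nonneg.2 (le_trans hs htT)
    simp only [Set.indicator_of_mem hs, Function.comp_apply, Set.indicator_of_mem this]
  · simp only [Set.indicator_of_notMem hs]

theorem IsLevyIntegral.sum (hsq : ∀ t, MemLp (L t) 2 Q) {f : Fin m → ℝ → Fin k → ℝ}
    {I : Fin m → Ω → ℝ} (h : ∀ i, IsLevyIntegral Q L (f i) (I i)) (S : Finset (Fin m)) :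
    IsLevyIntegral Q L (fun s => ∑ i ∈ S, f i s) (fun ω => ∑ i ∈ S, I i ω) := by
  classical
  induction S using Finset.induction_on with
  | empty =>
    simpa using
      (isLevyIntegral_step hsq (StepFunction.single (le_refl (0 : ℝ)) 0)).const_mul 0
  | insert i S hi ih =>
    simp only [Finset.sum_insert hi]
    exact (h i).add hsq ih

theorem isLevyIntegral_dotProduct_kernelIntegral (hL : IsTwoSidedLevy Q L)
    (hsq : ∀ t, MemLp (L t) 2 Q) (hmean : ∀ t, ∫ ω, L t ω ∂Q = 0)
    (hG : ∀ i j, MemLp (fun u => G u i j) 2 (volume.restrict (Set.Ici (0 : ℝ)))) {t T : ℝ}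
    (htT : t ≤ T) (z : Fin m → ℝ) :
    IsLevyIntegral Q L ((Set.Iic t).indicator fun s => (G (T - s))ᵀ *ᵥ z)
      (fun ω => z ⬝ᵥ kernelIntegral Q L G T t ω) := by
  have h := IsLevyIntegral.sum hsq (fun i => (IsLevyIntegral.levyIntegral hL hsq hmean
    (memLp_indicator_kernel hG htT i)).const_mul (z i)) Finset.univ
  refine h.congr (ae_of_all _ fun s => ?_) (ae_of_all _ fun ω => rfl)
  by_cases hs : s ∈ Set.Iic t
  · simp only [Set.indicator_of_mem hs]
    ext j
    simp [mulVec, dotProduct, mul_comm]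
  · simp [Set.indicator_of_notMem hs]

/-- Reflection s ↦ T - s preserves Lebesgue measure, and off A the integrand is the cumulant at 0,
which vanishes. -/
theorem lintegral_extCumulant_indicator_sub (g : ℝ → Fin k → ℝ) (T : ℝ) {A B : Set ℝ}
    (hB : MeasurableSet B) (hAB : ∀ s, s ∈ A ↔ T - s ∈ B) :
    ∫⁻ s, extCumulant Q L (A.indicator (fun s => g (T - s)) s) =
      ∫⁻ s in B, extCumulant Q L (g s) := by
  rw [← lintegral_indicator hB, ← lintegral_sub_left_eq_self (B.indicator _) T]
  refine lintegral_congr fun s => ?_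
  by_cases hs : s ∈ A
  · rw [Set.indicator_of_mem hs, Set.indicator_of_mem ((hAB s).1 hs)]
  · rw [Set.indicator_of_notMem hs, Set.indicator_of_notMem fun h => hs ((hAB s).2 h),
      extCumulant_zero]

/-- exp Y is pulled out and exp Z, being independent of `m₁`, averages to a constant; this is done
on strictly measurable versions. -/
theorem condExp_exp_add_of_indep {Ω : Type*} {m₁ m₂ mΩ : MeasurableSpace Ω} {Q : Measure Ω}
    [IsProbabilityMeasure Q] (hm₁ : m₁ ≤ mΩ) (hm₂ : m₂ ≤ mΩ) (h : Indep m₂ m₁ Q) {Y Z : Ω → ℝ}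
    (hY : AEStronglyMeasurable[m₁] Y Q) (hZ : AEStronglyMeasurable[m₂] Z Q)
    (hYZ : Integrable (fun ω => Real.exp (Y ω + Z ω)) Q)
    (hZi : Integrable (fun ω => Real.exp (Z ω)) Q) :
    Q[fun ω => Real.exp (Y ω + Z ω) | m₁] =ᵐ[Q]
      fun ω => Real.exp (Y ω) * ∫ ω, Real.exp (Z ω) ∂Q := by
  obtain ⟨Y', hY', hYY'⟩ := hY
  obtain ⟨Z', hZ', hZZ'⟩ := hZ
  set F : Ω → ℝ := fun ω => Real.exp (Y' ω) with hF
  set E : Ω → ℝ := fun ω => Real.exp (Z' ω) with hE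
  have hFm : StronglyMeasurable[m₁] F := Real.continuous_exp.comp_stronglyMeasurable hY'
  have hEm : StronglyMeasurable[m₂] E := Real.continuous_exp.comp_stronglyMeasurable hZ'
  have e1 : (fun ω => Real.exp (Y ω + Z ω)) =ᵐ[Q] F * E := by
    filter_upwards [hYY', hZZ'] with ω h1 h2
    simp only [hF, hE, Pi.mul_apply, h1, h2, Real.exp_add]
  have e2 : (fun ω => Real.exp (Z ω)) =ᵐ[Q] E := by
    filter_upwards [hZZ'] with ω h2
    simp only [hE, h2]
  have h3 := condExp_mul_of_stronglyMeasurable_left hFm (hYZ.congr e1) (hZi.congr e2)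
  have h4 := condExp_indep_eq hm₂ hm₁ hEm h
  filter_upwards [condExp_congr_ae (m := m₁) e1, h3, h4, hYY'] with ω h5 h6 h7 h8
  rw [h5, h6, Pi.mul_apply, h7, integral_congr_ae e2, h8]

end Kernel

/-! ### The conditional expectation formula -/

theorem proposition3p9 {Ω : Type*} [mΩ : MeasurableSpace Ω]
    (Q : Measure Ω) [IsProbabilityMeasure Q] (ℱ : Filtration ℝ≥0 mΩ)
    (m k : ℕ) (L : ℝ → Ω → Fin k → ℝ)
    (hL : IsTwoSidedLevy Q L) (hLℱ : IsLevyFiltration Q ℱ L)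
    (hL_sq : ∀ t, MemLp (L t) 2 Q) (hL_mean : ∀ t, ∫ ω, L t ω ∂Q = 0)
    (G : ℝ → Matrix (Fin m) (Fin k) ℝ)
    (hG : ∀ i j, MemLp (fun u => G u i j) 2 (volume.restrict (Set.Ici (0 : ℝ))))
    (t T : ℝ≥0) (htT : t ≤ T) (z : Fin m → ℝ)
    (hz : Integrable (fun ω => Real.exp (z ⬝ᵥ lsProcess Q L G t ω)) Q) :
    -- all quantities in the formula are well defined
    Integrable (fun ω => Real.exp (z ⬝ᵥ kernelIntegral Q L G T T ω)) Q ∧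
    (∀ᵐ s ∂volume.restrict (Set.Ioc (0 : ℝ) (T - t)),
      Integrable (fun ω => Real.exp (((G s)ᵀ *ᵥ z) ⬝ᵥ L 1 ω)) Q) ∧
    IntervalIntegrable (fun s => cumulant Q (L 1) ((G s)ᵀ *ᵥ z)) volume 0 (T - t) ∧
    -- the conditional expectation formula
    Q[fun ω => Real.exp (z ⬝ᵥ kernelIntegral Q L G T T ω) | ℱ t] =ᵐ[Q]
      fun ω => Real.exp (z ⬝ᵥ kernelIntegral Q L G T t ω +
        ∫ s in (0 : ℝ)..(T - t), cumulant Q (L 1) ((G s)ᵀ *ᵥ z)) := by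
  set g : ℝ → Fin k → ℝ := fun s => (G s)ᵀ *ᵥ z with hg
  have hT : (t : ℝ) ≤ T := htT
  have hfut : futureIncrements L t ≤ mΩ :=
    futureIncrements_le fun p _ => (hL.measurable p).sub (hL.measurable t)
  have hIt := isLevyIntegral_dotProduct_kernelIntegral hL hL_sq hL_mean hG (le_refl (t : ℝ)) z
  have hIT := isLevyIntegral_dotProduct_kernelIntegral hL hL_sq hL_mean hG (le_refl (T : ℝ)) z
  have hIY := isLevyIntegral_dotProduct_kernelIntegral hL hL_sq hL_mean hG hT z
  -- The right side does not depend on r: this is the stationarity that carries the moment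
  -- hypothesis from time t to time T.
  have hcum : ∀ r : ℝ, levyCumulant Q L ((Set.Iic r).indicator fun s => g (r - s)) =
      ∫⁻ s in Set.Ici 0, extCumulant Q L (g s) := by
    intro r
    rw [levyCumulant_eq_lintegral hL hL_sq hL_mean
      (isLevyIntegral_dotProduct_kernelIntegral hL hL_sq hL_mean hG (le_refl r) z).1]
    exact lintegral_extCumulant_indicator_sub g r measurableSet_Ici fun s => by simp
  have hfin : ∫⁻ s in Set.Ici 0, extCumulant Q L (g s) ≠ ⊤ := by
    rw [← hcum t, hIt.levyCumulant_eq hL hL_sq hL_mean (ae_eq_refl _), Ne, logPos_eq_top_iff]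
    exact (integrable_exp_iff hIt.2.1.aestronglyMeasurable).1 hz
  have hintT : Integrable (fun ω => Real.exp (z ⬝ᵥ kernelIntegral Q L G T T ω)) Q := by
    rw [integrable_exp_iff hIT.2.1.aestronglyMeasurable, Ne, ← logPos_eq_top_iff,
      ← hIT.levyCumulant_eq hL hL_sq hL_mean (ae_eq_refl _), hcum T]
    exact hfin
  have hgm : AEMeasurable g (volume.restrict (Set.Ici (0 : ℝ))) := by
    refine aemeasurable_pi_lambda _ fun j => ?_
    simp only [hg, mulVec, dotProduct, transpose_apply]
    exact Finset.aemeasurable_fun_sum _ fun i _ =>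
      (hG i j).aestronglyMeasurable.aemeasurable.mul_const _
  have hΨm : AEMeasurable (fun s => extCumulant Q L (g s)) (volume.restrict (Set.Ici (0 : ℝ))) :=
    (measurable_extCumulant (hL.measurable 1)).comp_aemeasurable hgm
  have hsub : Set.Ioc (0 : ℝ) (T - t) ⊆ Set.Ici 0 := fun s hs => hs.1.le
  have hΨm' := hΨm.mono_measure (Measure.restrict_mono_set volume hsub)
  have hfin' : ∫⁻ s in Set.Ioc (0 : ℝ) (T - t), extCumulant Q L (g s) ≠ ⊤ :=
    ne_top_of_le_ne_top hfin (lintegral_mono_set hsub)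
  have hcum' : (fun s => cumulant Q (L 1) ((G s)ᵀ *ᵥ z)) =
      fun s => (extCumulant Q L (g s)).toReal :=
    funext fun s => cumulant_eq_toReal hL hL_sq hL_mean _
  refine ⟨hintT, ?_, ?_, ?_⟩
  · filter_upwards [ae_lt_top' hΨm' hfin'] with s hs
    rw [integrable_exp_iff (memLp_dotProduct (hL_sq 1) _).aestronglyMeasurable, Ne,
      ← logPos_eq_top_iff]
    exact hs.ne
  · rw [intervalIntegrable_iff_integrableOn_Ioc_of_le (sub_nonneg.2 hT), hcum']
    exact integrable_toReal_of_lintegral_ne_top hΨm' hfin'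
  -- The integrand of the full integral, to be cut at t.
  · set f : ℝ → Fin k → ℝ := (Set.Iic (T : ℝ)).indicator fun s => g (T - s) with hf
    have hfY : (Set.Iic (t : ℝ)).indicator f = (Set.Iic (t : ℝ)).indicator fun s => g (T - s) := by
      rw [hf, Set.indicator_indicator, Set.Iic_inter_Iic, inf_eq_left.2 hT]
    have hfZ : (Set.Ioi (t : ℝ)).indicator f =
        (Set.Ioc (t : ℝ) T).indicator fun s => g (T - s) := by
      rw [hf, Set.indicator_indicator, Set.Ioi_inter_Iic]
    rw [← hfY] at hIY
    set Z := levyIntegral Q L ((Set.Ioi (t : ℝ)).indicator f) with hZ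
    have hIZ : IsLevyIntegral Q L ((Set.Ioi (t : ℝ)).indicator f) Z :=
      IsLevyIntegral.levyIntegral hL hL_sq hL_mean (hIT.1.indicator measurableSet_Ioi)
    have hYm : AEStronglyMeasurable[ℱ t] (fun ω => z ⬝ᵥ kernelIntegral Q L G T t ω) Q :=
      hIY.aestronglyMeasurable_of_indicator_Iic hL hL_sq hL_mean hIT.1 (ℱ.le t)
        fun p q hp hq => (hLℱ.adapted t q hq).sub (hLℱ.adapted t p hp)
    have hZm := hIZ.aestronglyMeasurable_of_indicator_Ioi hL hL_sq hL_mean hIT.1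
    have hsum : (fun ω => z ⬝ᵥ kernelIntegral Q L G T T ω) =ᵐ[Q]
        fun ω => z ⬝ᵥ kernelIntegral Q L G T t ω + Z ω := by
      refine hIT.ae_eq hL hL_sq hL_mean (hIY.add hL_sq hIZ) (ae_of_all _ fun s => ?_)
      by_cases hs : s ≤ t
      · simp [hs, hf]
      · simp [hs, not_le.1 hs, hf]
    have hexp : (fun ω => Real.exp (z ⬝ᵥ kernelIntegral Q L G T T ω)) =ᵐ[Q]
        fun ω => Real.exp (z ⬝ᵥ kernelIntegral Q L G T t ω + Z ω) := by
      filter_upwards [hsum] with ω hω using by rw [hω]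
    -- The reflection maps (t, T] onto [0, T - t), which differs from (0, T - t] by a null set.
    have hZcum : logPos (expMoment Q Z) =
        ∫⁻ s in Set.Ioc (0 : ℝ) (T - t), extCumulant Q L (g s) := by
      rw [← hIZ.levyCumulant_eq hL hL_sq hL_mean (ae_eq_refl _),
        levyCumulant_eq_lintegral hL hL_sq hL_mean hIZ.1, hfZ,
        lintegral_extCumulant_indicator_sub g T (B := Set.Ico 0 (T - t)) measurableSet_Ico,
        Measure.restrict_congr_set Ico_ae_eq_Ioc]
      intro s
      simp only [Set.mem_Ioc, Set.mem_Ico, sub_nonneg, sub_lt_sub_iff_left]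
      tauto
    have hZi : Integrable (fun ω => Real.exp (Z ω)) Q := by
      rw [integrable_exp_iff hIZ.2.1.aestronglyMeasurable, Ne, ← logPos_eq_top_iff, hZcum]
      exact hfin'
    have hZint : ∫ ω, Real.exp (Z ω) ∂Q =
        Real.exp (∫ s in (0 : ℝ)..(T - t), cumulant Q (L 1) ((G s)ᵀ *ᵥ z)) := by
      have h1 := logPos_expMoment_toReal hIZ.2.1.aestronglyMeasurable
        (hIZ.one_le_expMoment hL_sq hL_mean)
      rw [intervalIntegral.integral_of_le (sub_nonneg.2 hT), hcum',
        integral_toReal hΨm' (ae_lt_top' hΨm' hfin'), ← hZcum, ← h1,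
        Real.exp_log (integral_exp_pos hZi)]
    have hcond := condExp_exp_add_of_indep (ℱ.le t) hfut (hLℱ.indep_future hL.measurable t) hYm hZm
      (hintT.congr hexp) hZi
    refine (condExp_congr_ae hexp).trans (hcond.trans (ae_of_all _ fun ω => ?_))
    simp only [hZint, Real.exp_add]
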